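/- Let $\mathbf H$ be a $2\times 2$ random matrix with independent entries $\mathbf H_{ij}\sim\mathcal{CN}(0,\phi_{ij})$ (circularly symmetric complex Gaussian with $\mathbb E|\mathbf H_{ij}|^2=\phi_{ij}$), where $\phi_{ij}>0$ for $i,j=1,2$, and let $\mathbf W=\mathbf H\mathbf H^\dagger$. Put $K=\prod_{1\le i,j\le 2}\frac1{\phi_{ij}}$, $s_i=\frac1{\phi_{i1}}+\frac1{\phi_{i2}}$ and $\epsilon_i=\frac1{\phi_{i1}}-\frac1{\phi_{i2}}$, and assume $\epsilon_i\neq 0$ for some $i$. Then the pair of ordered eigenvalues $\lambda_1\ge\lambda_2>0$ of $\mathbf W$ has a joint probability density function with respect to Lebesgue measure on $\mathbb R^2$; it vanishes outside the region $\lambda_1\ge\lambda_2>0$, and on this region it is given, for almost every $(\lambda_1,\lambda_2)$, by \[ p(\lambda_1,\lambda_2)=2K(\lambda_1-\lambda_2)^2\int_0^{\pi/2}e^{-\frac12\nu(\lambda_1,\lambda_2,\kappa)}\,\frac{\sinh\left(\frac12\sqrt{\eta(\lambda_1,\lambda_2,\kappa)}\right)}{\sqrt{\eta(\lambda_1,\lambda_2,\kappa)}}\,\sin(2\kappa)\,d\kappa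 , \] where, with $a_\kappa=\cos^2\kappa$ and $b_\kappa=\sin^2\kappa$, \[ \nu(\lambda_1,\lambda_2,\kappa)=(a_\kappa\lambda_1+b_\kappa\lambda_2)s_1+(b_\kappa\lambda_1+a_\kappa\lambda_2)s_2 , \] \[ \eta(\lambda_1,\lambda_2,\kappa)=(a_\kappa\lambda_1+b_\kappa\lambda_2)^2\epsilon_1^2+(b_\kappa\lambda_1+a_\kappa\lambda_2)^2\epsilon_2^2+2\left(a_\kappa b_\kappa(\lambda_1-\lambda_2)^2-\lambda_1\lambda_2\right)\epsilon_1\epsilon_2 , \] and the integral converges for all $\lambda_1\ge\lambda_2>0$ (with the integrand read as $0$ where $\eta=0$). -/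

import Mathlib

open MeasureTheory ProbabilityTheory
open scoped NNReal ENNReal

noncomputable section

/-- The circularly symmetric complex Gaussian law `CN(0, v)`: the real and imaginary parts are
independent real Gaussians of mean `0` and variance `v / 2`, so that `E |z|² = v`. -/
def complexGaussian (v : ℝ≥0) : Measure ℂ :=
  ((gaussianReal 0 (v / 2)).prod (gaussianReal 0 (v / 2))).map
    (fun p : ℝ × ℝ => (⟨p.1, p.2⟩ : ℂ))

/-- The eigenvalues of the Gram matrix `A Aᴴ` with multiplicity, in decreasing order:
index `0` is the largest one, index `1` the smallest one. -/
def gramEigenvalue (A : Matrix (Fin 2) (Fin 2) ℂ) (i : Fin 2) : ℝ :=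
  (Matrix.isHermitian_mul_conjTranspose_self A).eigenvalues₀
    (Fin.cast (Fintype.card_fin 2).symm i)

/-- `K = ∏ 1 / φ i j`. -/
def profileK (φ : Fin 2 → Fin 2 → ℝ≥0) : ℝ := ∏ i, ∏ j, 1 / (φ i j : ℝ)

/-- The sum of the inverse variances of row `i`. -/
def profileS (φ : Fin 2 → Fin 2 → ℝ≥0) (i : Fin 2) : ℝ :=
  1 / (φ i 0 : ℝ) + 1 / (φ i 1 : ℝ)

/-- The difference of the inverse variances of row `i`. -/
def profileEps (φ : Fin 2 → Fin 2 → ℝ≥0) (i : Fin 2) : ℝ :=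
  1 / (φ i 0 : ℝ) - 1 / (φ i 1 : ℝ)

/-- `a_κ = cos² κ`. -/
def aCoef (κ : ℝ) : ℝ := Real.cos κ ^ 2

/-- `b_κ = sin² κ`. -/
def bCoef (κ : ℝ) : ℝ := Real.sin κ ^ 2

/-- `ν(x, y, κ)`. -/
def nuFun (φ : Fin 2 → Fin 2 → ℝ≥0) (x y κ : ℝ) : ℝ :=
  (aCoef κ * x + bCoef κ * y) * profileS φ 0 + (bCoef κ * x + aCoef κ * y) * profileS φ 1

/-- `η(x, y, κ)`. -/
def etaFun (φ : Fin 2 → Fin 2 → ℝ≥0) (x y κ : ℝ) : ℝ :=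
  (aCoef κ * x + bCoef κ * y) ^ 2 * profileEps φ 0 ^ 2
    + (bCoef κ * x + aCoef κ * y) ^ 2 * profileEps φ 1 ^ 2
    + 2 * (aCoef κ * bCoef κ * (x - y) ^ 2 - x * y) * profileEps φ 0 * profileEps φ 1

/-- The integrand (in `κ`) of the eigenvalue density. For `x > y > 0` and not both
`profileEps φ i` zero, `etaFun φ x y κ` is positive for `0 < κ < π / 2`. -/
def eigenIntegrand (φ : Fin 2 → Fin 2 → ℝ≥0) (x y κ : ℝ) : ℝ :=
  Real.exp (-(1 / 2) * nuFun φ x y κ)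
    * (Real.sinh (1 / 2 * √(etaFun φ x y κ)) / √(etaFun φ x y κ)) * Real.sin (2 * κ)

/-- The claimed joint density at `(x, y)` with `x ≥ y > 0`. -/
def eigenDensity (φ : Fin 2 → Fin 2 → ℝ≥0) (x y : ℝ) : ℝ :=
  2 * profileK φ * (x - y) ^ 2 * ∫ κ in (0 : ℝ)..(Real.pi / 2), eigenIntegrand φ x y κ

end

/-!
The law of the eigenvalues is computed by testing it against nonnegative measurable functions, so
that every step is an identity between lower Lebesgue integrals and no integrability has to be
carried along.

The eigenvalues of `H Hᴴ` are the roots of a quadratic polynomial whose coefficients are the trace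
`‖h₀₀‖² + ‖h₀₁‖² + ‖h₁₀‖² + ‖h₁₁‖²` and the determinant `|h₀₀ h₁₁ - h₀₁ h₁₀|²`
(`gramEigenvalue_pair`). The squared moduli `A, B, C, D` of the entries are independent exponential
variables, and `|det H|² = A D + B C - 2 √(A B C D) cos θ` with a uniform phase `θ`, which the phase
of a single entry already provides (`lintegral_complexGaussian_mul_sub`).

In the row variables `x = A + B`, `u = (B - A) / x` and `y = C + D`, `v = (D - C) / y`, the numbers
`u` and `v` are the heights of two points `n`, `m` of the unit sphere in `ℝ³` (the Bloch vectors of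
the rows), `θ` is, up to a shift, the difference of their longitudes, and
`|det H|² = x y (1 - ⟪n, m⟫) / 2`. Integrating over all configurations with a prescribed
`t = ⟪n, m⟫` replaces the exponential of a linear form in `u`, `v` by `sinh N / N`, where `N` is the
norm of the corresponding combination of `n` and `m` (`lintegral_sphere_pair`). The proof
substitutes `t` for `θ`; this produces the weight `(gramDet u v t)^(-1/2)`, which is symmetric in
its arguments, and for fixed `t` a linear change of the variables `u`, `v` turns it into the weight
`(1 - c² - d²)^(-1/2)` on the unit disc.

It remains to pass from `(x, y, t)` to the eigenvalues and the angle `κ`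
(`lintegral_eigenvalue_coordinates`). With `S = x + y = l₁ + l₂`, `d = x - y` and `δ = l₁ - l₂`, one
has `S² - δ² = 2 x y (1 - t)`, so `x y dt = δ dδ`, and `d = δ cos 2κ`.
-/

/-! ### Changes of variables for lower Lebesgue integrals -/

theorem lintegral_comp_affine (m : ℝ) {c : ℝ} (hc : c ≠ 0) (g : ℝ → ℝ≥0∞) :
    ∫⁻ t, g t = ENNReal.ofReal |c| * ∫⁻ s, g (m + c * s) := by
  have h := lintegral_image_eq_lintegral_abs_deriv_mul (s := Set.univ)
    (f := fun s : ℝ => m + c * s) (f' := fun _ => c) MeasurableSet.univ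
    (fun x _ => by
      simpa using (((hasDerivAt_id' x).const_mul c).const_add m).hasDerivWithinAt (s := Set.univ))
    (fun x _ y _ hxy => by simpa [hc] using hxy) g
  have himg : (fun s : ℝ => m + c * s) '' Set.univ = Set.univ := by
    refine Set.eq_univ_of_forall fun t => ⟨(t - m) / c, trivial, ?_⟩
    dsimp only
    field_simp
    ring
  rw [himg, setLIntegral_univ, setLIntegral_univ] at h
  rw [h, lintegral_const_mul' _ _ ENNReal.ofReal_ne_top]

theorem lintegral_comp_linear (a b c d : ℝ) (hdet : a * d - b * c ≠ 0) (f : ℝ × ℝ → ℝ≥0∞) :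
    ∫⁻ p, f p =
      ENNReal.ofReal |a * d - b * c| * ∫⁻ p : ℝ × ℝ, f (a * p.1 + b * p.2, c * p.1 + d * p.2) := by
  let M : ℝ × ℝ →L[ℝ] ℝ × ℝ :=
    (Matrix.toLin (.finTwoProd ℝ) (.finTwoProd ℝ) !![a, b; c, d]).toContinuousLinearMap
  have hM : ∀ p, M p = (a * p.1 + b * p.2, c * p.1 + d * p.2) := fun p => by
    simp [M, Matrix.toLin_finTwoProd_apply]
  have hMdet : M.det = a * d - b * c := by
    simp only [M, LinearMap.det_toContinuousLinearMap, LinearMap.det_toLin, Matrix.det_fin_two_of]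
  have hinj : Set.InjOn M Set.univ := by
    rintro ⟨x, y⟩ - ⟨x', y'⟩ - h
    rw [hM, hM, Prod.mk.injEq] at h
    obtain ⟨h1, h2⟩ := h
    dsimp only at h1 h2
    have e1 : (a * d - b * c) * (x - x') = 0 := by linear_combination d * h1 - b * h2
    have e2 : (a * d - b * c) * (y - y') = 0 := by linear_combination a * h2 - c * h1
    have e1' := (mul_eq_zero.1 e1).resolve_left hdet
    have e2' := (mul_eq_zero.1 e2).resolve_left hdet
    ext <;> dsimp only <;> linarith
  have himg : M '' Set.univ = Set.univ := by
    refine Set.eq_univ_of_forall fun p =>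
      ⟨((d * p.1 - b * p.2) / (a * d - b * c), (a * p.2 - c * p.1) / (a * d - b * c)), trivial, ?_⟩
    rw [hM]
    ext
    · dsimp only
      rw [mul_div_assoc', mul_div_assoc', ← add_div, div_eq_iff hdet]
      ring
    · dsimp only
      rw [mul_div_assoc', mul_div_assoc', ← add_div, div_eq_iff hdet]
      ring
  have h := lintegral_image_eq_lintegral_abs_det_fderiv_mul (volume : Measure (ℝ × ℝ))
    MeasurableSet.univ (fun p _ => M.hasFDerivAt.hasFDerivWithinAt (x := p)) hinj f
  rw [himg, setLIntegral_univ, setLIntegral_univ] at h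
  simp only [hMdet, hM] at h
  rw [h, lintegral_const_mul' _ _ ENNReal.ofReal_ne_top]

/-- Passing to the sum `S` and the difference `d` of two positive variables. -/
theorem lintegral_sum_diff {g : ℝ → ℝ → ℝ≥0∞} (hg : Measurable fun p : ℝ × ℝ => g p.1 p.2) :
    ∫⁻ x in Set.Ioi 0, ∫⁻ y in Set.Ioi 0, g x y =
      ENNReal.ofReal (1 / 2) * ∫⁻ S in Set.Ioi 0, ∫⁻ d in Set.Ioo (-S) S,
        g ((S + d) / 2) ((S - d) / 2) := by
  let F : ℝ × ℝ → ℝ≥0∞ := (Set.Ioi 0 ×ˢ Set.Ioi 0).indicator fun p => g p.1 p.2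
  have hF : Measurable F := hg.indicator (measurableSet_Ioi.prod measurableSet_Ioi)
  have hL : ∫⁻ x in Set.Ioi 0, ∫⁻ y in Set.Ioi 0, g x y = ∫⁻ p, F p := by
    rw [lintegral_indicator (measurableSet_Ioi.prod measurableSet_Ioi),
      Measure.volume_eq_prod, ← Measure.prod_restrict, lintegral_prod _ hg.aemeasurable]
  rw [hL, lintegral_comp_linear (1 / 2) (1 / 2) (1 / 2) (-1 / 2) (by norm_num) F]
  congr 1
  · norm_num [abs_of_neg]
  rw [Measure.volume_eq_prod, lintegral_prod _ (by fun_prop),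
    ← lintegral_indicator measurableSet_Ioi]
  refine lintegral_congr fun S => ?_
  by_cases hS : S ∈ Set.Ioi (0 : ℝ)
  · rw [Set.indicator_of_mem hS, ← lintegral_indicator measurableSet_Ioo]
    refine lintegral_congr fun d => ?_
    simp only [F, Set.indicator, Set.mem_prod, Set.mem_Ioi, Set.mem_Ioo]
    have hiff : (0 < 1 / 2 * S + 1 / 2 * d ∧ 0 < 1 / 2 * S + -1 / 2 * d) ↔ (-S < d ∧ d < S) := by
      constructor <;> rintro ⟨h1, h2⟩ <;> constructor <;> linarith
    simp only [hiff]
    congr 2 <;> ring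
  · rw [Set.indicator_of_notMem hS]
    refine (lintegral_congr fun d => ?_).trans lintegral_zero
    refine Set.indicator_of_notMem ?_ _
    rintro ⟨h1, h2⟩
    simp only [Set.mem_Ioi] at h1 h2 hS
    linarith

/-- Passing to the sum `S` and the relative difference `u` of two positive variables. -/
theorem lintegral_sum_ratio {g : ℝ → ℝ → ℝ≥0∞} (hg : Measurable fun p : ℝ × ℝ => g p.1 p.2) :
    ∫⁻ x in Set.Ioi 0, ∫⁻ y in Set.Ioi 0, g x y =
      ∫⁻ S in Set.Ioi 0, ∫⁻ u in Set.Ioo (-1) 1,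
        ENNReal.ofReal (S / 2) * g (S * (1 + u) / 2) (S * (1 - u) / 2) := by
  rw [lintegral_sum_diff hg, ← lintegral_const_mul' _ _ ENNReal.ofReal_ne_top]
  refine setLIntegral_congr_fun measurableSet_Ioi fun S hS => ?_
  have hS : 0 < S := hS
  rw [← lintegral_indicator measurableSet_Ioo, lintegral_comp_affine 0 hS.ne',
    ← lintegral_indicator measurableSet_Ioo, ← mul_assoc, ← ENNReal.ofReal_mul (by norm_num),
    ← lintegral_const_mul' _ _ ENNReal.ofReal_ne_top]
  refine lintegral_congr fun u => ?_
  have hiff : 0 + S * u ∈ Set.Ioo (-S) S ↔ u ∈ Set.Ioo (-1 : ℝ) 1 := by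
    simp only [Set.mem_Ioo]
    constructor <;> rintro ⟨h1, h2⟩ <;> constructor <;> nlinarith
  by_cases hu : u ∈ Set.Ioo (-1 : ℝ) 1
  · rw [Set.indicator_of_mem hu, Set.indicator_of_mem (hiff.2 hu), abs_of_pos hS]
    congr 2 <;> ring_nf
  · rw [Set.indicator_of_notMem hu, Set.indicator_of_notMem (mt hiff.1 hu), mul_zero]

/-- The arcsine law: the pushforward of Lebesgue measure on `(0, π)` by `cos`. Outside `(-1, 1)`
the weight vanishes since `√` of a nonpositive number is `0`, and so is `0⁻¹`. -/
theorem lintegral_comp_cos (h : ℝ → ℝ≥0∞) :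
    ∫⁻ θ in Set.Ioo 0 Real.pi, h (Real.cos θ) =
      ∫⁻ s, ENNReal.ofReal (√(1 - s ^ 2))⁻¹ * h s := by
  have hinj : Set.InjOn Real.cos (Set.Ioo 0 Real.pi) :=
    Real.injOn_cos.mono Set.Ioo_subset_Icc_self
  have himg : Real.cos '' Set.Ioo 0 Real.pi = Set.Ioo (-1) 1 := by
    ext s
    constructor
    · rintro ⟨θ, hθ, rfl⟩
      have h1 := Real.cos_lt_cos_of_nonneg_of_le_pi le_rfl hθ.2.le hθ.1
      have h2 := Real.cos_lt_cos_of_nonneg_of_le_pi hθ.1.le le_rfl hθ.2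
      rw [Real.cos_zero] at h1
      rw [Real.cos_pi] at h2
      exact ⟨h2, h1⟩
    · rintro ⟨h1, h2⟩
      exact ⟨Real.arccos s, ⟨Real.arccos_pos.2 h2, Real.arccos_lt_pi.2 h1⟩,
        Real.cos_arccos h1.le h2.le⟩
  have key := lintegral_image_eq_lintegral_abs_deriv_mul measurableSet_Ioo
    (fun θ _ => (Real.hasDerivAt_cos θ).hasDerivWithinAt) hinj
    (fun s => ENNReal.ofReal (√(1 - s ^ 2))⁻¹ * h s)
  rw [himg] at key
  have hL : ∫⁻ s, ENNReal.ofReal (√(1 - s ^ 2))⁻¹ * h s =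
      ∫⁻ s in Set.Ioo (-1) 1, ENNReal.ofReal (√(1 - s ^ 2))⁻¹ * h s := by
    rw [← lintegral_indicator measurableSet_Ioo]
    refine lintegral_congr fun s => ?_
    by_cases hs : s ∈ Set.Ioo (-1 : ℝ) 1
    · rw [Set.indicator_of_mem hs]
    · have : 1 - s ^ 2 ≤ 0 := by
        by_contra hcon
        exact hs (abs_lt.1 ((sq_lt_one_iff_abs_lt_one s).1 (by linarith)))
      rw [Set.indicator_of_notMem hs, Real.sqrt_eq_zero_of_nonpos this]
      simp
  rw [hL, key]
  refine setLIntegral_congr_fun measurableSet_Ioo fun θ hθ => ?_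
  have hs : 0 < Real.sin θ := Real.sin_pos_of_pos_of_lt_pi hθ.1 hθ.2
  rw [← mul_assoc, ← ENNReal.ofReal_mul (abs_nonneg _), ← Real.abs_sin_eq_sqrt_one_sub_cos_sq,
    abs_neg, abs_of_pos hs, mul_inv_cancel₀ hs.ne', ENNReal.ofReal_one, one_mul]

theorem lintegral_comp_affine_cos (m : ℝ) {ρ : ℝ} (hρ : 0 < ρ) (g : ℝ → ℝ≥0∞) :
    ∫⁻ θ in Set.Ioo 0 Real.pi, g (m + ρ * Real.cos θ) =
      ∫⁻ t, ENNReal.ofReal (√(ρ ^ 2 - (t - m) ^ 2))⁻¹ * g t := by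
  rw [lintegral_comp_cos fun s => g (m + ρ * s),
    lintegral_comp_affine m hρ.ne' fun t => ENNReal.ofReal (√(ρ ^ 2 - (t - m) ^ 2))⁻¹ * g t,
    ← lintegral_const_mul' _ _ ENNReal.ofReal_ne_top]
  refine lintegral_congr fun s => ?_
  have h1 : ρ ^ 2 - (m + ρ * s - m) ^ 2 = ρ ^ 2 * (1 - s ^ 2) := by ring
  rw [h1, Real.sqrt_mul (sq_nonneg ρ), Real.sqrt_sq hρ.le, ← mul_assoc,
    ← ENNReal.ofReal_mul (abs_nonneg _), abs_of_pos hρ, mul_inv, mul_inv_cancel_left₀ hρ.ne']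

theorem lintegral_inv_sqrt_sub_sq (r : ℝ) :
    ∫⁻ d, ENNReal.ofReal (√(r - d ^ 2))⁻¹ =
      (Set.Ioi 0).indicator (fun _ => ENNReal.ofReal Real.pi) r := by
  by_cases hr : r ∈ Set.Ioi (0 : ℝ)
  · have hr' : 0 < r := hr
    have h := lintegral_comp_affine_cos 0 (Real.sqrt_pos.2 hr') fun _ => 1
    simp only [Real.sq_sqrt hr'.le, sub_zero, mul_one, lintegral_const, one_mul,
      Measure.restrict_apply_univ, Real.volume_Ioo] at h
    rw [← h, Set.indicator_of_mem hr]
  · rw [Set.indicator_of_notMem hr]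
    refine (lintegral_congr fun d => ?_).trans lintegral_zero
    have : r - d ^ 2 ≤ 0 := by
      have : r ≤ 0 := not_lt.1 hr
      nlinarith [sq_nonneg d]
    rw [Real.sqrt_eq_zero_of_nonpos this]
    simp

/-! ### The exponential integral over pairs of points on the sphere -/

theorem setLIntegral_eq_lintegral_of_forall_notMem {α : Type*} [MeasurableSpace α] {μ : Measure α}
    {s : Set α} (hs : MeasurableSet s) {f : α → ℝ≥0∞} (hf : ∀ x ∉ s, f x = 0) :
    ∫⁻ x in s, f x ∂μ = ∫⁻ x, f x ∂μ := by
  rw [← lintegral_indicator hs, Set.indicator_eq_self.2]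
  exact fun x hx => by_contra fun h => hx (hf x h)

theorem lintegral_exp_neg_mul {N : ℝ} (hN : 0 < N) :
    ∫⁻ c in Set.Ioo (-1) 1, ENNReal.ofReal (Real.exp (-(N * c))) =
      ENNReal.ofReal (2 * Real.sinh N / N) := by
  have hint : ∫ c in (-1 : ℝ)..1, Real.exp (-(N * c)) = 2 * Real.sinh N / N := by
    have h := intervalIntegral.integral_comp_mul_left (a := -1) (b := 1) Real.exp
      (neg_ne_zero.2 hN.ne')
    simp only [neg_mul] at h
    rw [h, integral_exp, Real.sinh_eq, smul_eq_mul]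
    field_simp
    ring_nf
  rw [← hint, intervalIntegral.integral_of_le (by norm_num), ofReal_integral_eq_lintegral_ofReal,
    restrict_Ioo_eq_restrict_Ioc]
  · exact (Continuous.integrableOn_Icc (by fun_prop)).mono_set Set.Ioc_subset_Icc_self
  · exact Filter.Eventually.of_forall fun _ => (Real.exp_pos _).le

/-- The determinant of the Gram matrix of three unit vectors with pairwise inner products
`u`, `v`, `t`. -/
def gramDet (u v t : ℝ) : ℝ := 1 - u ^ 2 - v ^ 2 - t ^ 2 + 2 * u * v * t

theorem gramDet_nonpos_of_notMem {u v t : ℝ} (ht : t ∈ Set.Ioo (-1 : ℝ) 1)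
    (hu : u ∉ Set.Ioo (-1 : ℝ) 1) : gramDet u v t ≤ 0 := by
  have ht' : t ^ 2 < 1 := (sq_lt_one_iff_abs_lt_one t).2 (abs_lt.2 ht)
  have hu' : 1 ≤ u ^ 2 := by
    by_contra hcon
    exact hu (abs_lt.1 ((sq_lt_one_iff_abs_lt_one u).1 (by linarith)))
  have : gramDet u v t = (1 - t ^ 2) * (1 - u ^ 2) - (v - u * t) ^ 2 := by unfold gramDet; ring
  rw [this]
  nlinarith [sq_nonneg (v - u * t)]

theorem gramDet_swap (u v t : ℝ) : gramDet u v t = gramDet v u t := by unfold gramDet; ring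

theorem gramDet_rotate (u v t : ℝ) : gramDet u v t = gramDet t v u := by unfold gramDet; ring

theorem ofReal_inv_sqrt_eq_zero {r : ℝ} (hr : r ≤ 0) : ENNReal.ofReal (√r)⁻¹ = 0 := by
  rw [Real.sqrt_eq_zero_of_nonpos hr]
  simp

/-- `‖α n + β m‖² > 0` for unit vectors `n ≠ ±m` with inner product `t`. -/
theorem add_two_mul_pos {α β t : ℝ} (h : α ≠ 0 ∨ β ≠ 0) (ht : t ∈ Set.Ioo (-1 : ℝ) 1) :
    0 < α ^ 2 + β ^ 2 + 2 * α * β * t := by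
  have ht' : t ^ 2 < 1 := (sq_lt_one_iff_abs_lt_one t).2 (abs_lt.2 ht)
  by_cases hβ : β = 0
  · have : 0 < α ^ 2 := by have := h.resolve_right (not_not.2 hβ); positivity
    subst hβ
    simpa using this
  · have h1 : α ^ 2 + β ^ 2 + 2 * α * β * t = (α + β * t) ^ 2 + β ^ 2 * (1 - t ^ 2) := by ring
    have : 0 < β ^ 2 * (1 - t ^ 2) := mul_pos (by positivity) (by linarith)
    rw [h1]
    positivity

/-- For unit vectors `n`, `m` with inner product `t`, the coordinates `u = ⟪n, e⟫`, `v = ⟪m, e⟫`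
of a uniformly distributed unit vector `e` have density proportional to `(gramDet u v t)^(-1/2)`.
In orthonormal coordinates `(c, d)` of the plane spanned by `n` and `m`, with `c` along
`α n + β m`, the exponent is `-N c` and the weight becomes that of the unit disc. -/
theorem lintegral_exp_mul_inv_sqrt_gramDet {α β t : ℝ} (h : α ≠ 0 ∨ β ≠ 0)
    (ht : t ∈ Set.Ioo (-1 : ℝ) 1) :
    ∫⁻ u, ∫⁻ v, ENNReal.ofReal (Real.exp (-(α * u + β * v))) *
        ENNReal.ofReal (√(gramDet u v t))⁻¹ =
      ENNReal.ofReal (2 * Real.pi * (Real.sinh √(α ^ 2 + β ^ 2 + 2 * α * β * t) /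
        √(α ^ 2 + β ^ 2 + 2 * α * β * t))) := by
  have hpos := add_two_mul_pos h ht
  set N := √(α ^ 2 + β ^ 2 + 2 * α * β * t) with hNdef
  have hN : 0 < N := Real.sqrt_pos.2 hpos
  have hN2 : N ^ 2 = α ^ 2 + β ^ 2 + 2 * α * β * t := Real.sq_sqrt hpos.le
  have ht' : t ^ 2 < 1 := (sq_lt_one_iff_abs_lt_one t).2 (abs_lt.2 ht)
  set τ := √(1 - t ^ 2) with hτdef
  have hτ : 0 < τ := Real.sqrt_pos.2 (by linarith)
  have hτ2 : τ ^ 2 = 1 - t ^ 2 := Real.sq_sqrt (by linarith)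
  have hmeas : Measurable fun p : ℝ × ℝ =>
      ENNReal.ofReal (Real.exp (-(α * p.1 + β * p.2))) *
        ENNReal.ofReal (√(gramDet p.1 p.2 t))⁻¹ := by
    unfold gramDet
    fun_prop
  -- The coordinates of `n` and `m` along `α n + β m` and orthogonally to it.
  obtain ⟨p, hp⟩ : ∃ p, p = (α + β * t) / N := ⟨_, rfl⟩
  obtain ⟨q, hq⟩ : ∃ q, q = (α * t + β) / N := ⟨_, rfl⟩
  obtain ⟨a, ha⟩ : ∃ a, a = β * τ / N := ⟨_, rfl⟩
  obtain ⟨b, hb⟩ : ∃ b, b = -(α * τ) / N := ⟨_, rfl⟩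
  have e1 : α * p + β * q = N := by
    rw [hp, hq]; field_simp; linear_combination -hN2
  have e2 : α * a + β * b = 0 := by
    rw [ha, hb]; field_simp; ring
  have e3 : p ^ 2 + q ^ 2 - 2 * t * (p * q) = τ ^ 2 := by
    rw [hp, hq]; field_simp; linear_combination -N ^ 2 * hτ2 - (1 - t ^ 2) * hN2
  have e4 : a ^ 2 + b ^ 2 - 2 * t * (a * b) = τ ^ 2 := by
    rw [ha, hb]; field_simp; linear_combination -hN2
  have e5 : p * a + q * b - t * (p * b + q * a) = 0 := by
    rw [hp, hq, ha, hb]; field_simp; ring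
  have e6 : p * b - a * q = -τ := by
    rw [hp, hq, ha, hb]; field_simp; linear_combination hN2
  have hG : ∀ c d, gramDet (p * c + a * d) (q * c + b * d) t =
      τ ^ 2 * ((1 - c ^ 2) - d ^ 2) := fun c d => by
    unfold gramDet
    linear_combination -hτ2 - c ^ 2 * e3 - d ^ 2 * e4 - 2 * c * d * e5
  have hX : ∀ c d, -(α * (p * c + a * d) + β * (q * c + b * d)) = -(N * c) := fun c d => by
    linear_combination -c * e1 - d * e2
  rw [← lintegral_prod _ hmeas.aemeasurable, ← Measure.volume_eq_prod,
    lintegral_comp_linear p a q b (by rw [e6]; exact neg_ne_zero.2 hτ.ne'), e6, abs_neg,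
    abs_of_pos hτ]
  simp only [hG, hX]
  rw [Measure.volume_eq_prod, lintegral_prod _ (by fun_prop)]
  have hinner : ∀ c : ℝ, ∫⁻ d, ENNReal.ofReal (Real.exp (-(N * c))) *
      ENNReal.ofReal (√(τ ^ 2 * ((1 - c ^ 2) - d ^ 2)))⁻¹ =
      ENNReal.ofReal τ⁻¹ * (Set.Ioo (-1) 1).indicator
        (fun c => ENNReal.ofReal Real.pi * ENNReal.ofReal (Real.exp (-(N * c)))) c := fun c => by
    rw [lintegral_const_mul' _ _ ENNReal.ofReal_ne_top]
    simp only [Real.sqrt_mul (sq_nonneg τ), Real.sqrt_sq hτ.le, mul_inv,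
      ENNReal.ofReal_mul (inv_nonneg.2 hτ.le)]
    rw [lintegral_const_mul' _ _ ENNReal.ofReal_ne_top, lintegral_inv_sqrt_sub_sq]
    have hiff : 1 - c ^ 2 ∈ Set.Ioi (0 : ℝ) ↔ c ∈ Set.Ioo (-1 : ℝ) 1 := by
      rw [Set.mem_Ioi, sub_pos, sq_lt_one_iff_abs_lt_one, abs_lt, Set.mem_Ioo]
    by_cases hc : c ∈ Set.Ioo (-1 : ℝ) 1
    · rw [Set.indicator_of_mem hc, Set.indicator_of_mem (hiff.2 hc)]
      ring
    · rw [Set.indicator_of_notMem hc, Set.indicator_of_notMem (mt hiff.1 hc)]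
      simp
  simp only [hinner]
  rw [lintegral_const_mul' _ _ ENNReal.ofReal_ne_top, lintegral_indicator measurableSet_Ioo,
    lintegral_const_mul' _ _ ENNReal.ofReal_ne_top, lintegral_exp_neg_mul hN, ← mul_assoc,
    ← ENNReal.ofReal_mul hτ.le, mul_inv_cancel₀ hτ.ne', ENNReal.ofReal_one, one_mul,
    ← ENNReal.ofReal_mul Real.pi_pos.le]
  congr 1
  ring

theorem lintegral_comp_cos_eq_gramDet {u v : ℝ} (hu : u ∈ Set.Ioo (-1 : ℝ) 1)
    (hv : v ∈ Set.Ioo (-1 : ℝ) 1) (g : ℝ → ℝ≥0∞) :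
    ∫⁻ θ in Set.Ioo 0 Real.pi, g (u * v + √(1 - u ^ 2) * √(1 - v ^ 2) * Real.cos θ) =
      ∫⁻ t in Set.Ioo (-1) 1, ENNReal.ofReal (√(gramDet u v t))⁻¹ * g t := by
  have hu' : 0 < 1 - u ^ 2 := sub_pos.2 ((sq_lt_one_iff_abs_lt_one u).2 (abs_lt.2 hu))
  have hv' : 0 < 1 - v ^ 2 := sub_pos.2 ((sq_lt_one_iff_abs_lt_one v).2 (abs_lt.2 hv))
  rw [lintegral_comp_affine_cos _ (mul_pos (Real.sqrt_pos.2 hu') (Real.sqrt_pos.2 hv')),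
    setLIntegral_eq_lintegral_of_forall_notMem measurableSet_Ioo]
  · refine lintegral_congr fun t => ?_
    rw [mul_pow, Real.sq_sqrt hu'.le, Real.sq_sqrt hv'.le]
    congr 4
    unfold gramDet
    ring
  · intro t ht
    rw [gramDet_rotate, ofReal_inv_sqrt_eq_zero (gramDet_nonpos_of_notMem hu ht), zero_mul]

theorem lintegral_lintegral_lintegral_rotate {μ ν ρ : Measure ℝ} [SFinite μ] [SFinite ν] [SFinite ρ]
    {k : ℝ → ℝ → ℝ → ℝ≥0∞} (hk : Measurable fun p : ℝ × ℝ × ℝ => k p.1 p.2.1 p.2.2) :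
    ∫⁻ u, ∫⁻ v, ∫⁻ t, k u v t ∂ρ ∂ν ∂μ = ∫⁻ t, ∫⁻ u, ∫⁻ v, k u v t ∂ν ∂μ ∂ρ := by
  calc
    _ = ∫⁻ u, ∫⁻ t, ∫⁻ v, k u v t ∂ν ∂ρ ∂μ := by
      refine lintegral_congr fun u => lintegral_lintegral_swap (Measurable.aemeasurable ?_)
      exact hk.comp (by fun_prop : Measurable fun p : ℝ × ℝ => (u, p.1, p.2))
    _ = _ := by
      refine lintegral_lintegral_swap (Measurable.aemeasurable ?_)
      refine Measurable.lintegral_prod_right' (f := fun p : (ℝ × ℝ) × ℝ => k p.1.1 p.2 p.1.2) ?_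
      exact hk.comp (by fun_prop : Measurable fun p : (ℝ × ℝ) × ℝ => (p.1.1, p.2, p.1.2))

/-- The law of the inner product `t` of two uniformly distributed points on the unit sphere of
`ℝ³`, weighted by the exponential of a linear combination of their heights `u`, `v`; here `θ` is
the difference of their longitudes. -/
theorem lintegral_sphere_pair {α β : ℝ} (h : α ≠ 0 ∨ β ≠ 0) {g : ℝ → ℝ≥0∞} (hg : Measurable g) :
    ∫⁻ u in Set.Ioo (-1) 1, ∫⁻ v in Set.Ioo (-1) 1,
        ENNReal.ofReal (Real.exp (-(α * u + β * v))) *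
          ∫⁻ θ in Set.Ioo 0 Real.pi,
            g (u * v + √(1 - u ^ 2) * √(1 - v ^ 2) * Real.cos θ) =
      ∫⁻ t in Set.Ioo (-1) 1,
        ENNReal.ofReal (2 * Real.pi * (Real.sinh √(α ^ 2 + β ^ 2 + 2 * α * β * t) /
          √(α ^ 2 + β ^ 2 + 2 * α * β * t))) * g t := by
  let k : ℝ → ℝ → ℝ → ℝ≥0∞ := fun u v t => ENNReal.ofReal (Real.exp (-(α * u + β * v))) *
    ENNReal.ofReal (√(gramDet u v t))⁻¹ * g t
  have hk : Measurable fun p : ℝ × ℝ × ℝ => k p.1 p.2.1 p.2.2 := by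
    simp only [k, gramDet]
    fun_prop
  calc
    _ = ∫⁻ u in Set.Ioo (-1) 1, ∫⁻ v in Set.Ioo (-1) 1, ∫⁻ t in Set.Ioo (-1) 1, k u v t := by
      refine setLIntegral_congr_fun measurableSet_Ioo fun u hu =>
        setLIntegral_congr_fun measurableSet_Ioo fun v hv => ?_
      rw [lintegral_comp_cos_eq_gramDet hu hv, ← lintegral_const_mul' _ _ ENNReal.ofReal_ne_top]
      simp only [k, mul_assoc]
    _ = ∫⁻ t in Set.Ioo (-1) 1, ∫⁻ u in Set.Ioo (-1) 1, ∫⁻ v in Set.Ioo (-1) 1, k u v t :=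
      lintegral_lintegral_lintegral_rotate hk
    _ = _ := by
      refine setLIntegral_congr_fun measurableSet_Ioo fun t ht => ?_
      rw [← lintegral_exp_mul_inv_sqrt_gramDet h ht, ← lintegral_mul_const,
        setLIntegral_eq_lintegral_of_forall_notMem measurableSet_Ioo]
      · refine lintegral_congr fun u => ?_
        rw [← lintegral_mul_const _ (by unfold gramDet; fun_prop),
          setLIntegral_eq_lintegral_of_forall_notMem measurableSet_Ioo]
        intro v hv
        simp only [k]
        rw [gramDet_swap, ofReal_inv_sqrt_eq_zero (gramDet_nonpos_of_notMem ht hv), mul_zero,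
          zero_mul]
      · intro u hu
        refine (lintegral_congr fun v => ?_).trans lintegral_zero
        simp only [k]
        rw [ofReal_inv_sqrt_eq_zero (gramDet_nonpos_of_notMem ht hu), mul_zero, zero_mul]
      · refine Measurable.lintegral_prod_right' (f := fun p : ℝ × ℝ =>
          ENNReal.ofReal (Real.exp (-(α * p.1 + β * p.2))) *
            ENNReal.ofReal (√(gramDet p.1 p.2 t))⁻¹) ?_
        unfold gramDet
        fun_prop

/-! ### Eigenvalue coordinates -/

/-- For fixed `S = x + y` and `d = x - y`, passing from `t` to the eigenvalue gap `δ`, where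
`S² - δ² = 2 x y (1 - t)`. -/
theorem lintegral_cos_to_gap {S d : ℝ} (hd : d ∈ Set.Ioo (-S) S) (g : ℝ → ℝ≥0∞) :
    ∫⁻ t in Set.Ioo (-1) 1, ENNReal.ofReal ((S + d) / 2 * ((S - d) / 2)) * g t =
      ∫⁻ δ in Set.Ioo |d| S,
        ENNReal.ofReal δ * g (1 - 2 * (S ^ 2 - δ ^ 2) / (S ^ 2 - d ^ 2)) := by
  have hdS : |d| < S := abs_lt.2 hd
  have hD : 0 < S ^ 2 - d ^ 2 := by
    have := mul_pos (sub_pos.2 hd.2) (neg_lt_iff_pos_add.1 hd.1)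
    nlinarith
  have hder : ∀ δ ∈ Set.Ioo |d| S, HasDerivWithinAt
      (fun δ => 1 - 2 * (S ^ 2 - δ ^ 2) / (S ^ 2 - d ^ 2)) (4 * δ / (S ^ 2 - d ^ 2))
      (Set.Ioo |d| S) δ := fun δ _ => by
    refine HasDerivAt.hasDerivWithinAt ?_
    convert (((((hasDerivAt_pow 2 δ).const_sub (S ^ 2)).const_mul 2).div_const
      (S ^ 2 - d ^ 2)).const_sub 1) using 1
    push_cast
    ring
  have hinj : Set.InjOn (fun δ => 1 - 2 * (S ^ 2 - δ ^ 2) / (S ^ 2 - d ^ 2))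
      (Set.Ioo |d| S) := by
    intro x hx y hy hxy
    dsimp only at hxy
    have hx0 : 0 < x := (abs_nonneg d).trans_lt hx.1
    have hy0 : 0 < y := (abs_nonneg d).trans_lt hy.1
    field_simp at hxy
    nlinarith
  have himg : (fun δ => 1 - 2 * (S ^ 2 - δ ^ 2) / (S ^ 2 - d ^ 2)) '' Set.Ioo |d| S =
      Set.Ioo (-1) 1 := by
    ext t
    constructor
    · rintro ⟨δ, ⟨h1, h2⟩, rfl⟩
      have hδ0 : 0 < δ := (abs_nonneg d).trans_lt h1
      have h3 : d ^ 2 < δ ^ 2 := by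
        rw [← sq_abs d]
        exact pow_lt_pow_left₀ h1 (abs_nonneg d) two_ne_zero
      have h4 : δ ^ 2 < S ^ 2 := pow_lt_pow_left₀ h2 hδ0.le two_ne_zero
      dsimp only
      rw [Set.mem_Ioo, neg_lt_sub_iff_lt_add, sub_lt_self_iff, ← sub_pos]
      constructor
      · have : 1 + 1 - 2 * (S ^ 2 - δ ^ 2) / (S ^ 2 - d ^ 2) =
            2 * (δ ^ 2 - d ^ 2) / (S ^ 2 - d ^ 2) := by field_simp; ring
        rw [this]
        exact div_pos (by linarith) hD
      · exact div_pos (by linarith) hD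
    · rintro ⟨h1, h2⟩
      have hS0 : 0 < S := (abs_nonneg d).trans_lt hdS
      have h3 : d ^ 2 < S ^ 2 - (1 - t) * (S ^ 2 - d ^ 2) / 2 := by nlinarith
      refine ⟨√(S ^ 2 - (1 - t) * (S ^ 2 - d ^ 2) / 2), ⟨?_, ?_⟩, ?_⟩
      · rw [← Real.sqrt_sq_eq_abs]
        exact Real.sqrt_lt_sqrt (sq_nonneg d) h3
      · rw [Real.sqrt_lt' hS0]
        nlinarith
      · dsimp only
        rw [Real.sq_sqrt ((sq_nonneg d).trans h3.le)]
        field_simp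
        ring
  rw [← himg, lintegral_image_eq_lintegral_abs_deriv_mul measurableSet_Ioo hder hinj]
  refine setLIntegral_congr_fun measurableSet_Ioo fun δ hδ => ?_
  have hδ0 : 0 < δ := (abs_nonneg d).trans_lt hδ.1
  rw [abs_of_pos (by positivity), ← mul_assoc, ← ENNReal.ofReal_mul (by positivity)]
  congr 2
  field_simp
  ring

theorem lintegral_gap_cos {δ : ℝ} (hδ : 0 < δ) (g : ℝ → ℝ≥0∞) :
    ∫⁻ d in Set.Ioo (-δ) δ, g d =
      ∫⁻ κ in Set.Ioo 0 (Real.pi / 2),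
        ENNReal.ofReal (2 * δ * Real.sin (2 * κ)) * g (δ * Real.cos (2 * κ)) := by
  have hder : ∀ κ ∈ Set.Ioo 0 (Real.pi / 2), HasDerivWithinAt
      (fun κ => δ * Real.cos (2 * κ)) (-(2 * δ * Real.sin (2 * κ)))
      (Set.Ioo 0 (Real.pi / 2)) κ := fun κ _ => by
    refine HasDerivAt.hasDerivWithinAt ?_
    refine ((((hasDerivAt_id' κ).const_mul 2).cos).const_mul δ).congr_deriv ?_
    ring
  have hinj : Set.InjOn (fun κ => δ * Real.cos (2 * κ)) (Set.Ioo 0 (Real.pi / 2)) := by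
    intro x hx y hy hxy
    have h1 : Real.cos (2 * x) = Real.cos (2 * y) := mul_left_cancel₀ hδ.ne' hxy
    have := Real.injOn_cos ⟨by linarith [hx.1], by linarith [hx.2]⟩
      ⟨by linarith [hy.1], by linarith [hy.2]⟩ h1
    linarith
  have himg : (fun κ => δ * Real.cos (2 * κ)) '' Set.Ioo 0 (Real.pi / 2) = Set.Ioo (-δ) δ := by
    ext d
    constructor
    · rintro ⟨κ, ⟨h1, h2⟩, rfl⟩
      have h3 := Real.cos_lt_cos_of_nonneg_of_le_pi le_rfl (by linarith : 2 * κ ≤ Real.pi)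
        (by linarith)
      have h4 := Real.cos_lt_cos_of_nonneg_of_le_pi (by linarith : 0 ≤ 2 * κ) le_rfl
        (by linarith)
      rw [Real.cos_zero] at h3
      rw [Real.cos_pi] at h4
      constructor <;> dsimp only <;> nlinarith
    · rintro ⟨h1, h2⟩
      have h3 : -1 < d / δ := by rw [lt_div_iff₀ hδ]; linarith
      have h4 : d / δ < 1 := by rw [div_lt_iff₀ hδ]; linarith
      refine ⟨Real.arccos (d / δ) / 2, ⟨?_, ?_⟩, ?_⟩
      · linarith [Real.arccos_pos.2 h4]
      · linarith [Real.arccos_lt_pi.2 h3]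
      · dsimp only
        rw [mul_div_cancel₀ _ two_ne_zero, Real.cos_arccos h3.le h4.le]
        field_simp
  rw [← himg, lintegral_image_eq_lintegral_abs_deriv_mul measurableSet_Ioo hder hinj]
  refine setLIntegral_congr_fun measurableSet_Ioo fun κ hκ => ?_
  have hs : 0 < Real.sin (2 * κ) :=
    Real.sin_pos_of_pos_of_lt_pi (by linarith [hκ.1]) (by linarith [hκ.2])
  rw [abs_neg, abs_of_pos (by positivity)]

theorem lintegral_gap_swap (S : ℝ) {k : ℝ → ℝ → ℝ≥0∞}
    (hk : Measurable fun p : ℝ × ℝ => k p.1 p.2) :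
    ∫⁻ d in Set.Ioo (-S) S, ∫⁻ δ in Set.Ioo |d| S, k d δ =
      ∫⁻ δ in Set.Ioo 0 S, ∫⁻ d in Set.Ioo (-δ) δ, k d δ := by
  have hR : MeasurableSet {p : ℝ × ℝ | |p.1| < p.2 ∧ p.2 < S} :=
    (measurableSet_lt (f := fun p : ℝ × ℝ => |p.1|) (by fun_prop) measurable_snd).inter
      (measurableSet_lt measurable_snd measurable_const)
  let F : ℝ → ℝ → ℝ≥0∞ := fun d δ =>
    {p : ℝ × ℝ | |p.1| < p.2 ∧ p.2 < S}.indicator (fun p => k p.1 p.2) (d, δ)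
  calc
    _ = ∫⁻ d, ∫⁻ δ, F d δ := by
      rw [← lintegral_indicator measurableSet_Ioo]
      refine lintegral_congr fun d => ?_
      by_cases hd : d ∈ Set.Ioo (-S) S
      · rw [Set.indicator_of_mem hd, ← lintegral_indicator measurableSet_Ioo]
        rfl
      · rw [Set.indicator_of_notMem hd]
        refine ((lintegral_congr fun δ => ?_).trans lintegral_zero).symm
        refine Set.indicator_of_notMem (fun h => hd (abs_lt.1 ?_)) _
        exact lt_trans h.1 h.2
    _ = ∫⁻ δ, ∫⁻ d, F d δ := lintegral_lintegral_swap (hk.indicator hR).aemeasurable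
    _ = _ := by
      rw [← lintegral_indicator measurableSet_Ioo]
      refine lintegral_congr fun δ => ?_
      by_cases hδ : δ ∈ Set.Ioo 0 S
      · rw [Set.indicator_of_mem hδ, ← lintegral_indicator measurableSet_Ioo]
        refine lintegral_congr fun d => ?_
        by_cases hd : d ∈ Set.Ioo (-δ) δ
        · rw [Set.indicator_of_mem hd]
          have hmem : (d, δ) ∈ {p : ℝ × ℝ | |p.1| < p.2 ∧ p.2 < S} := ⟨abs_lt.2 hd, hδ.2⟩
          exact Set.indicator_of_mem hmem _
        · rw [Set.indicator_of_notMem hd]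
          exact Set.indicator_of_notMem (fun h => hd (abs_lt.1 h.1)) _
      · rw [Set.indicator_of_notMem hδ]
        refine (lintegral_congr fun d => ?_).trans lintegral_zero
        refine Set.indicator_of_notMem (fun h => hδ ⟨?_, h.2⟩) _
        exact (abs_nonneg d).trans_lt h.1

theorem aCoef_mul_add (x y κ : ℝ) :
    aCoef κ * x + bCoef κ * y = (x + y + (x - y) * Real.cos (2 * κ)) / 2 := by
  unfold aCoef bCoef
  rw [Real.cos_two_mul]
  linear_combination y * Real.sin_sq_add_cos_sq κ

theorem bCoef_mul_add (x y κ : ℝ) :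
    bCoef κ * x + aCoef κ * y = (x + y - (x - y) * Real.cos (2 * κ)) / 2 := by
  unfold aCoef bCoef
  rw [Real.cos_two_mul]
  linear_combination x * Real.sin_sq_add_cos_sq κ

/-- Change of variables from `(x, y, t)`, where `x`, `y` are the squared norms of the rows and
`t` is the inner product of their Bloch vectors, to the eigenvalues `l₁ > l₂` and the angle `κ` with
`x = a_κ l₁ + b_κ l₂`, `y = b_κ l₁ + a_κ l₂`, `x y (1 - t) / 2 = l₁ l₂`. -/
theorem lintegral_eigenvalue_coordinates {k : ℝ → ℝ → ℝ → ℝ≥0∞}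
    (hk : Measurable fun p : ℝ × ℝ × ℝ => k p.1 p.2.1 p.2.2) :
    ∫⁻ x in Set.Ioi 0, ∫⁻ y in Set.Ioi 0, ∫⁻ t in Set.Ioo (-1) 1,
        ENNReal.ofReal (x * y) * k x y t =
      ∫⁻ l₁ in Set.Ioi 0, ∫⁻ l₂ in Set.Ioi 0, {p : ℝ × ℝ | p.2 < p.1}.indicator
        (fun p => ∫⁻ κ in Set.Ioo 0 (Real.pi / 2),
          ENNReal.ofReal (2 * (p.1 - p.2) ^ 2 * Real.sin (2 * κ)) *
            k (aCoef κ * p.1 + bCoef κ * p.2) (bCoef κ * p.1 + aCoef κ * p.2)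
              (1 - 2 * (p.1 * p.2) / ((aCoef κ * p.1 + bCoef κ * p.2) *
                (bCoef κ * p.1 + aCoef κ * p.2)))) (l₁, l₂) := by
  have hkc : ∀ {f₁ f₂ f₃ : (ℝ × ℝ) × ℝ → ℝ}, Measurable f₁ → Measurable f₂ → Measurable f₃ →
      Measurable fun p => k (f₁ p) (f₂ p) (f₃ p) := fun h₁ h₂ h₃ =>
    hk.comp (h₁.prodMk (h₂.prodMk h₃))
  have hlt : MeasurableSet {p : ℝ × ℝ | p.2 < p.1} :=
    measurableSet_lt measurable_snd measurable_fst
  rw [lintegral_sum_diff, lintegral_sum_diff]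
  · congr 1
    refine setLIntegral_congr_fun measurableSet_Ioi fun S hS => ?_
    calc
      _ = ∫⁻ d in Set.Ioo (-S) S, ∫⁻ δ in Set.Ioo |d| S, ENNReal.ofReal δ *
            k ((S + d) / 2) ((S - d) / 2) (1 - 2 * (S ^ 2 - δ ^ 2) / (S ^ 2 - d ^ 2)) :=
        setLIntegral_congr_fun measurableSet_Ioo fun d hd =>
          lintegral_cos_to_gap hd fun t => k ((S + d) / 2) ((S - d) / 2) t
      _ = ∫⁻ δ in Set.Ioo 0 S, ∫⁻ d in Set.Ioo (-δ) δ, ENNReal.ofReal δ *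
            k ((S + d) / 2) ((S - d) / 2) (1 - 2 * (S ^ 2 - δ ^ 2) / (S ^ 2 - d ^ 2)) := by
        refine lintegral_gap_swap S (k := fun d δ => ENNReal.ofReal δ *
          k ((S + d) / 2) ((S - d) / 2) (1 - 2 * (S ^ 2 - δ ^ 2) / (S ^ 2 - d ^ 2))) ?_
        refine (by fun_prop : Measurable fun p : ℝ × ℝ => ENNReal.ofReal p.2).mul ?_
        exact hk.comp (by fun_prop : Measurable fun p : ℝ × ℝ => ((S + p.1) / 2, (S - p.1) / 2,
          1 - 2 * (S ^ 2 - p.2 ^ 2) / (S ^ 2 - p.1 ^ 2)))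
      _ = ∫⁻ δ in Set.Ioo 0 S, ∫⁻ κ in Set.Ioo 0 (Real.pi / 2),
            ENNReal.ofReal (2 * δ ^ 2 * Real.sin (2 * κ)) *
              k ((S + δ * Real.cos (2 * κ)) / 2) ((S - δ * Real.cos (2 * κ)) / 2)
                (1 - 2 * (S ^ 2 - δ ^ 2) / (S ^ 2 - (δ * Real.cos (2 * κ)) ^ 2)) := by
        refine setLIntegral_congr_fun measurableSet_Ioo fun δ hδ => ?_
        rw [lintegral_gap_cos hδ.1]
        refine setLIntegral_congr_fun measurableSet_Ioo fun κ hκ => ?_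
        have hs : 0 < Real.sin (2 * κ) :=
          Real.sin_pos_of_pos_of_lt_pi (by linarith [hκ.1]) (by linarith [hκ.2])
        have hδ0 : 0 < δ := hδ.1
        rw [← mul_assoc, ← ENNReal.ofReal_mul (by positivity)]
        congr 2
        ring
      _ = _ := by
        rw [← lintegral_indicator measurableSet_Ioo, ← lintegral_indicator measurableSet_Ioo]
        refine lintegral_congr fun δ => ?_
        by_cases hδ : δ ∈ Set.Ioo 0 S
        · have hmem : ((S + δ) / 2, (S - δ) / 2) ∈ {p : ℝ × ℝ | p.2 < p.1} := by
            simp only [Set.mem_ofPred_eq]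
            linarith [hδ.1]
          have hδ' : δ ∈ Set.Ioo (-S) S := ⟨by linarith [hδ.1, hδ.2], hδ.2⟩
          rw [Set.indicator_of_mem hδ, Set.indicator_of_mem hδ', Set.indicator_of_mem hmem]
          refine setLIntegral_congr_fun measurableSet_Ioo fun κ _ => ?_
          have e1 : aCoef κ * ((S + δ) / 2) + bCoef κ * ((S - δ) / 2) =
              (S + δ * Real.cos (2 * κ)) / 2 := by rw [aCoef_mul_add]; ring
          have e2 : bCoef κ * ((S + δ) / 2) + aCoef κ * ((S - δ) / 2) =
              (S - δ * Real.cos (2 * κ)) / 2 := by rw [bCoef_mul_add]; ring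
          have e3 : 2 * ((S + δ) / 2 * ((S - δ) / 2)) /
              ((S + δ * Real.cos (2 * κ)) / 2 * ((S - δ * Real.cos (2 * κ)) / 2)) =
              2 * (S ^ 2 - δ ^ 2) / (S ^ 2 - (δ * Real.cos (2 * κ)) ^ 2) := by
            rw [← mul_div_mul_left _ _ (four_ne_zero' ℝ)]
            congr 1 <;> ring
          simp only [e1, e2, e3]
          congr 3
          ring
        · rw [Set.indicator_of_notMem hδ]
          refine (Set.indicator_apply_eq_zero.2 fun hδ' => ?_).symm
          refine Set.indicator_of_notMem (fun hmem => hδ ⟨?_, hδ'.2⟩) _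
          simp only [Set.mem_ofPred_eq] at hmem
          linarith
  · refine Measurable.indicator ?_ hlt
    refine Measurable.lintegral_prod_right' (f := fun q : (ℝ × ℝ) × ℝ =>
      ENNReal.ofReal (2 * (q.1.1 - q.1.2) ^ 2 * Real.sin (2 * q.2)) *
        k (aCoef q.2 * q.1.1 + bCoef q.2 * q.1.2) (bCoef q.2 * q.1.1 + aCoef q.2 * q.1.2)
          (1 - 2 * (q.1.1 * q.1.2) / ((aCoef q.2 * q.1.1 + bCoef q.2 * q.1.2) *
            (bCoef q.2 * q.1.1 + aCoef q.2 * q.1.2)))) ?_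
    refine Measurable.mul (by fun_prop) ?_
    unfold aCoef bCoef
    exact hkc (by fun_prop) (by fun_prop) (by fun_prop)
  · refine Measurable.lintegral_prod_right' (f := fun q : (ℝ × ℝ) × ℝ =>
      ENNReal.ofReal (q.1.1 * q.1.2) * k q.1.1 q.1.2 q.2) ?_
    exact Measurable.mul (by fun_prop) (hkc (by fun_prop) (by fun_prop) (by fun_prop))

/-! ### Complex Gaussians in polar coordinates -/

theorem Function.Periodic.setLIntegral_add {h : ℝ → ℝ≥0∞} {T : ℝ} (hT : 0 < T)
    (hh : Function.Periodic h T) (a ψ : ℝ) :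
    ∫⁻ θ in Set.Ioc a (a + T), h (θ + ψ) = ∫⁻ θ in Set.Ioc a (a + T), h θ := by
  have h1 := (measurePreserving_add_right volume ψ).setLIntegral_comp_emb
    (measurableEmbedding_addRight ψ) h (Set.Ioc a (a + T))
  rw [h1, Set.image_add_const_Ioc, add_right_comm]
  refine (isAddFundamentalDomain_Ioc hT (a + ψ)).setLIntegral_eq (isAddFundamentalDomain_Ioc hT a)
    h ?_
  rintro ⟨g, hg⟩ x
  obtain ⟨n, rfl⟩ := AddSubgroup.mem_zmultiples_iff.1 hg
  change h (n • T + x) = h x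
  rw [add_comm]
  exact hh.zsmul n x

theorem setLIntegral_cos_add (h : ℝ → ℝ≥0∞) (ψ : ℝ) :
    ∫⁻ θ in Set.Ioo (-Real.pi) Real.pi, h (Real.cos (θ + ψ)) =
      2 * ∫⁻ θ in Set.Ioo 0 Real.pi, h (Real.cos θ) := by
  have hper : Function.Periodic (fun θ => h (Real.cos θ)) (2 * Real.pi) := fun θ => by
    simp only [Real.cos_add_two_pi]
  have h1 := hper.setLIntegral_add Real.two_pi_pos (-Real.pi) ψ
  have h2 : -Real.pi + 2 * Real.pi = Real.pi := by ring
  have hneg : ∫⁻ θ in Set.Ioo (-Real.pi) 0, h (Real.cos θ) =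
      ∫⁻ θ in Set.Ioo 0 Real.pi, h (Real.cos θ) := by
    have h3 := (Measure.measurePreserving_neg (volume : Measure ℝ)).setLIntegral_comp_emb
      (MeasurableEquiv.neg ℝ).measurableEmbedding (fun θ => h (Real.cos θ)) (Set.Ioo 0 Real.pi)
    simp only [Set.image_neg_eq_neg, Set.neg_Ioo, neg_zero, Real.cos_neg] at h3
    exact h3.symm
  have hunion : Set.Ioc (-Real.pi) Real.pi = Set.Ioc (-Real.pi) 0 ∪ Set.Ioc 0 Real.pi :=
    (Set.Ioc_union_Ioc_eq_Ioc (by linarith [Real.pi_pos]) Real.pi_pos.le).symm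
  rw [h2] at h1
  rw [restrict_Ioo_eq_restrict_Ioc, h1, hunion, lintegral_union measurableSet_Ioc,
    ← restrict_Ioo_eq_restrict_Ioc, ← restrict_Ioo_eq_restrict_Ioc, hneg, two_mul]
  exact Set.Ioc_disjoint_Ioc_of_le le_rfl

theorem lintegral_sq_Ioi (g : ℝ → ℝ≥0∞) :
    ∫⁻ r in Set.Ioi 0, ENNReal.ofReal r * g r =
      ENNReal.ofReal (1 / 2) * ∫⁻ A in Set.Ioi 0, g √A := by
  have himg : (fun r : ℝ => r ^ 2) '' Set.Ioi 0 = Set.Ioi 0 := by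
    ext A
    constructor
    · rintro ⟨r, hr, rfl⟩
      exact pow_pos (Set.mem_Ioi.1 hr) 2
    · intro hA
      exact ⟨√A, Real.sqrt_pos.2 hA, Real.sq_sqrt (le_of_lt hA)⟩
  have hinj : Set.InjOn (fun r : ℝ => r ^ 2) (Set.Ioi 0) := fun x hx y hy hxy =>
    (pow_left_inj₀ (le_of_lt hx) (le_of_lt hy) two_ne_zero).1 hxy
  have key := lintegral_image_eq_lintegral_abs_deriv_mul measurableSet_Ioi
    (fun r _ => (hasDerivAt_pow 2 r).hasDerivWithinAt) hinj fun A => g √A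
  rw [himg] at key
  rw [key, ← lintegral_const_mul' _ _ ENNReal.ofReal_ne_top]
  refine setLIntegral_congr_fun measurableSet_Ioi fun r hr => ?_
  have hr : 0 < r := hr
  rw [Real.sqrt_sq hr.le, ← mul_assoc, ← ENNReal.ofReal_mul (by norm_num), abs_of_nonneg]
  · congr 2
    push_cast
    ring
  · push_cast
    positivity

/-- The squared modulus is exponential of mean `v`, and the phase is uniform and independent of
it. -/
theorem lintegral_complexGaussian_polar {v : ℝ≥0} (hv : 0 < v) {g : ℂ → ℝ≥0∞}
    (hg : Measurable g) :
    ∫⁻ z, g z ∂complexGaussian v =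
      ∫⁻ A in Set.Ioi 0, ENNReal.ofReal (1 / v * Real.exp (-(A / v))) *
        (ENNReal.ofReal (1 / (2 * Real.pi)) *
          ∫⁻ θ in Set.Ioo (-Real.pi) Real.pi, g (√A * Complex.exp (θ * Complex.I))) := by
  have hv2 : v / 2 ≠ 0 := by positivity
  have hv' : (0 : ℝ) < v := hv
  have hmk : Measurable fun p : ℝ × ℝ => (⟨p.1, p.2⟩ : ℂ) :=
    Complex.measurableEquivRealProd.symm.measurable
  have hdens : ∀ x y : ℝ, gaussianPDF 0 (v / 2) x * gaussianPDF 0 (v / 2) y =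
      ENNReal.ofReal (1 / (Real.pi * v) * Real.exp (-((x ^ 2 + y ^ 2) / v))) := fun x y => by
    rw [gaussianPDF, gaussianPDF, ← ENNReal.ofReal_mul (gaussianPDFReal_nonneg _ _ _)]
    congr 1
    simp only [gaussianPDFReal, sub_zero, NNReal.coe_div, NNReal.coe_ofNat]
    rw [show 2 * Real.pi * ((v : ℝ) / 2) = Real.pi * v by ring, mul_mul_mul_comm, ← Real.exp_add,
      ← mul_inv, Real.mul_self_sqrt (by positivity), one_div]
    congr 2
    field_simp
    ring
  have hexp : ∀ r θ : ℝ, (r : ℂ) * Complex.exp (θ * Complex.I) =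
      ⟨r * Real.cos θ, r * Real.sin θ⟩ := fun r θ => by
    apply Complex.ext
    · rw [Complex.re_ofReal_mul, Complex.exp_ofReal_mul_I_re]
    · rw [Complex.im_ofReal_mul, Complex.exp_ofReal_mul_I_im]
  let G : ℝ × ℝ → ℝ≥0∞ := fun p => ENNReal.ofReal (1 / (Real.pi * v) *
    Real.exp (-((p.1 ^ 2 + p.2 ^ 2) / v))) * g ⟨p.1, p.2⟩
  have hgc : Measurable fun p : ℝ × ℝ => g (p.1 * Complex.exp (p.2 * Complex.I)) :=
    hg.comp (by fun_prop)
  calc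
    _ = ∫⁻ p, G p := by
      rw [complexGaussian, lintegral_map hg hmk, gaussianReal_of_var_ne_zero _ hv2,
        prod_withDensity (measurable_gaussianPDF _ _) (measurable_gaussianPDF _ _),
        ← Measure.volume_eq_prod]
      refine (lintegral_withDensity_eq_lintegral_mul _ (((measurable_gaussianPDF _ _).comp
        measurable_fst).mul ((measurable_gaussianPDF _ _).comp measurable_snd))
          (hg.comp hmk)).trans (lintegral_congr fun p => ?_)
      simp only [Pi.mul_apply, Function.comp_apply, hdens, G]
    _ = ∫⁻ r in Set.Ioi 0, ∫⁻ θ in Set.Ioo (-Real.pi) Real.pi, ENNReal.ofReal r *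
          (ENNReal.ofReal (1 / (Real.pi * v) * Real.exp (-(r ^ 2 / v))) *
            g (r * Complex.exp (θ * Complex.I))) := by
      rw [← lintegral_comp_polarCoord_symm, polarCoord_target, Measure.volume_eq_prod,
        ← Measure.prod_restrict, ← lintegral_prod (fun p : ℝ × ℝ => ENNReal.ofReal p.1 *
          (ENNReal.ofReal (1 / (Real.pi * v) * Real.exp (-(p.1 ^ 2 / v))) *
            g (p.1 * Complex.exp (p.2 * Complex.I)))) (by fun_prop)]
      refine lintegral_congr fun p => ?_
      simp only [polarCoord_symm_apply, smul_eq_mul, G, hexp]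
      congr 5
      linear_combination -(p.1 ^ 2 / v) * Real.sin_sq_add_cos_sq p.2
    _ = ∫⁻ r in Set.Ioi 0, ENNReal.ofReal r *
          (ENNReal.ofReal (1 / (Real.pi * v) * Real.exp (-(r ^ 2 / v))) *
            ∫⁻ θ in Set.Ioo (-Real.pi) Real.pi, g (r * Complex.exp (θ * Complex.I))) := by
      refine lintegral_congr fun r => ?_
      rw [lintegral_const_mul' _ _ ENNReal.ofReal_ne_top,
        lintegral_const_mul' _ _ ENNReal.ofReal_ne_top]
    _ = _ := by
      rw [lintegral_sq_Ioi fun r =>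
          ENNReal.ofReal (1 / (Real.pi * v) * Real.exp (-(r ^ 2 / v))) *
            ∫⁻ θ in Set.Ioo (-Real.pi) Real.pi, g (r * Complex.exp (θ * Complex.I)),
        ← lintegral_const_mul' _ _ ENNReal.ofReal_ne_top]
      refine setLIntegral_congr_fun measurableSet_Ioi fun A hA => ?_
      rw [Real.sq_sqrt (le_of_lt hA), ← mul_assoc, ← mul_assoc,
        ← ENNReal.ofReal_mul (by positivity), ← ENNReal.ofReal_mul (by positivity)]
      congr 2
      field_simp

theorem lintegral_complexGaussian_norm {v : ℝ≥0} (hv : 0 < v) {h : ℝ → ℝ≥0∞}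
    (hh : Measurable h) :
    ∫⁻ z, h ‖z‖ ∂complexGaussian v =
      ∫⁻ A in Set.Ioi 0, ENNReal.ofReal (1 / v * Real.exp (-(A / v))) * h √A := by
  rw [lintegral_complexGaussian_polar hv (g := fun z => h ‖z‖) (hh.comp measurable_norm)]
  refine lintegral_congr fun A => ?_
  congr 1
  simp only [norm_mul, Complex.norm_exp_ofReal_mul_I, Complex.norm_real,
    Real.norm_eq_abs, abs_of_nonneg (Real.sqrt_nonneg A), mul_one, lintegral_const,
    Measure.restrict_apply_univ, Real.volume_Ioo]
  rw [mul_left_comm, ← ENNReal.ofReal_mul (by positivity), sub_neg_eq_add, ← two_mul,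
    one_div_mul_cancel Real.two_pi_pos.ne', ENNReal.ofReal_one, mul_one]

theorem norm_polar_mul_sub_sq (r θ : ℝ) (w b : ℂ) :
    ‖(r * Complex.exp (θ * Complex.I)) * w - b‖ ^ 2 =
      r ^ 2 * ‖w‖ ^ 2 + ‖b‖ ^ 2 - 2 * r * ‖w‖ * ‖b‖ * Real.cos (θ + (w.arg - b.arg)) := by
  have h : (((r * Complex.exp (θ * Complex.I)) * w) * (starRingEnd ℂ) b).re =
      r * ‖w‖ * ‖b‖ * Real.cos (θ + (w.arg - b.arg)) := by
    conv_lhs => rw [← Complex.norm_mul_exp_arg_mul_I w, ← Complex.norm_mul_exp_arg_mul_I b]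
    rw [map_mul, ← Complex.exp_conj, Complex.conj_ofReal, map_mul, Complex.conj_ofReal,
      Complex.conj_I]
    have : (r * Complex.exp (θ * Complex.I)) * (‖w‖ * Complex.exp (w.arg * Complex.I)) *
        (‖b‖ * Complex.exp (b.arg * -Complex.I)) =
        ((r * ‖w‖ * ‖b‖ : ℝ) : ℂ) *
          Complex.exp ((θ + (w.arg - b.arg) : ℝ) * Complex.I) := by
      have h2 : ((θ + (w.arg - b.arg) : ℝ) : ℂ) * Complex.I =
          θ * Complex.I + w.arg * Complex.I + b.arg * -Complex.I := by push_cast; ring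
      rw [h2, Complex.exp_add, Complex.exp_add]
      push_cast
      ring
    rw [this, Complex.re_ofReal_mul, Complex.exp_ofReal_mul_I_re]
  rw [← Complex.normSq_eq_norm_sq, Complex.normSq_sub, h, Complex.normSq_mul, Complex.normSq_mul,
    Complex.normSq_ofReal, Complex.normSq_eq_norm_sq, Complex.normSq_eq_norm_sq,
    Complex.normSq_eq_norm_sq, Complex.norm_exp_ofReal_mul_I]
  ring

/-- The uniform phase of the single entry `z` makes the relative phase of `z w` and `b` uniform. -/
theorem lintegral_complexGaussian_mul_sub {v : ℝ≥0} (hv : 0 < v) {G : ℝ → ℝ → ℝ≥0∞}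
    (hG : Measurable fun p : ℝ × ℝ => G p.1 p.2) (w b : ℂ) :
    ∫⁻ z, G (‖z‖ ^ 2) (‖z * w - b‖ ^ 2) ∂complexGaussian v =
      ∫⁻ A in Set.Ioi 0, ENNReal.ofReal (1 / v * Real.exp (-(A / v))) *
        (ENNReal.ofReal (1 / Real.pi) * ∫⁻ θ in Set.Ioo 0 Real.pi,
          G A (A * ‖w‖ ^ 2 + ‖b‖ ^ 2 - 2 * √A * ‖w‖ * ‖b‖ * Real.cos θ)) := by
  rw [lintegral_complexGaussian_polar hv (g := fun z => G (‖z‖ ^ 2) (‖z * w - b‖ ^ 2))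
    (hG.comp (by fun_prop : Measurable fun z : ℂ => (‖z‖ ^ 2, ‖z * w - b‖ ^ 2)))]
  refine setLIntegral_congr_fun measurableSet_Ioi fun A hA => ?_
  simp only [norm_polar_mul_sub_sq, norm_mul, Complex.norm_exp_ofReal_mul_I, Complex.norm_real,
    Real.norm_eq_abs, abs_of_nonneg (Real.sqrt_nonneg A), mul_one, Real.sq_sqrt (le_of_lt hA)]
  rw [setLIntegral_cos_add (fun c => G A (A * ‖w‖ ^ 2 + ‖b‖ ^ 2 - 2 * √A * ‖w‖ * ‖b‖ * c)),
    ← mul_assoc (ENNReal.ofReal (1 / (2 * Real.pi))),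
    show (2 : ℝ≥0∞) = ENNReal.ofReal 2 by simp, ← ENNReal.ofReal_mul (by positivity),
    show 1 / (2 * Real.pi) * 2 = 1 / Real.pi by field_simp]

/-! ### From the entries to the squared row norms and the angle between the rows -/

/-- The density at `A > 0` of the exponential law of mean `v`, the law of the squared modulus of a
`CN(0, v)` variable. -/
noncomputable def expDensity (v : ℝ≥0) (A : ℝ) : ℝ := 1 / v * Real.exp (-(A / v))

theorem expDensity_nonneg (v : ℝ≥0) (A : ℝ) : 0 ≤ expDensity v A := by
  unfold expDensity
  positivity

@[fun_prop]
theorem measurable_expDensity (v : ℝ≥0) : Measurable (expDensity v) := by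
  unfold expDensity
  fun_prop

/-- The value at a `2 × 2` matrix with squared moduli `A`, `B`, `C`, `D` of the entries (in reading
order) of a function of the squared Frobenius norm and of the squared modulus of the determinant,
integrated over the relative phase `θ` of the two products in the determinant. -/
noncomputable def phaseIntegral (G : ℝ → ℝ → ℝ≥0∞) (A B C D : ℝ) : ℝ≥0∞ :=
  ∫⁻ θ in Set.Ioo 0 Real.pi,
    G (A + B + C + D) (A * D + B * C - 2 * (√A * √B) * (√C * √D) * Real.cos θ)

theorem measurable_phaseIntegral {α : Type*} [MeasurableSpace α] {G : ℝ → ℝ → ℝ≥0∞}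
    (hG : Measurable fun p : ℝ × ℝ => G p.1 p.2) {A B C D : α → ℝ} (hA : Measurable A)
    (hB : Measurable B) (hC : Measurable C) (hD : Measurable D) :
    Measurable fun a => phaseIntegral G (A a) (B a) (C a) (D a) := by
  unfold phaseIntegral
  refine Measurable.lintegral_prod_right' (f := fun q : α × ℝ =>
    G (A q.1 + B q.1 + C q.1 + D q.1) (A q.1 * D q.1 + B q.1 * C q.1 -
      2 * (√(A q.1) * √(B q.1)) * (√(C q.1) * √(D q.1)) * Real.cos q.2)) ?_
  exact hG.comp (by fun_prop : Measurable fun q : α × ℝ =>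
    (A q.1 + B q.1 + C q.1 + D q.1, A q.1 * D q.1 + B q.1 * C q.1 -
      2 * (√(A q.1) * √(B q.1)) * (√(C q.1) * √(D q.1)) * Real.cos q.2))

/-- Once the phase of `z₀₀` is integrated out, the integrand depends on the moduli only; this is why
`z₀₀` comes innermost. -/
theorem lintegral_gaussian_entries {φ : Fin 2 → Fin 2 → ℝ≥0} (hφ : ∀ i j, 0 < φ i j)
    {G : ℝ → ℝ → ℝ≥0∞} (hG : Measurable fun p : ℝ × ℝ => G p.1 p.2) :
    ∫⁻ z₁₁, ∫⁻ z₁₀, ∫⁻ z₀₁, ∫⁻ z₀₀,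
        G (‖z₀₀‖ ^ 2 + ‖z₀₁‖ ^ 2 + ‖z₁₀‖ ^ 2 + ‖z₁₁‖ ^ 2) (‖z₀₀ * z₁₁ - z₀₁ * z₁₀‖ ^ 2)
        ∂complexGaussian (φ 0 0) ∂complexGaussian (φ 0 1)
        ∂complexGaussian (φ 1 0) ∂complexGaussian (φ 1 1) =
      ∫⁻ D in Set.Ioi 0, ∫⁻ C in Set.Ioi 0, ∫⁻ B in Set.Ioi 0, ∫⁻ A in Set.Ioi 0,
        ENNReal.ofReal (expDensity (φ 1 1) D) * (ENNReal.ofReal (expDensity (φ 1 0) C) *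
          (ENNReal.ofReal (expDensity (φ 0 1) B) * (ENNReal.ofReal (expDensity (φ 0 0) A) *
            (ENNReal.ofReal (1 / Real.pi) * phaseIntegral G A B C D)))) := by
  let R : ℝ → ℝ → ℝ → ℝ≥0∞ := fun B C D => ∫⁻ A in Set.Ioi 0,
    ENNReal.ofReal (expDensity (φ 0 0) A) *
      (ENNReal.ofReal (1 / Real.pi) * phaseIntegral G A B C D)
  have hR : ∀ {α : Type} [MeasurableSpace α] {B C D : α → ℝ}, Measurable B → Measurable C →
      Measurable D → Measurable fun a => R (B a) (C a) (D a) := by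
    intro α _ B C D hB hC hD
    refine Measurable.lintegral_prod_right' (f := fun q : α × ℝ =>
      ENNReal.ofReal (expDensity (φ 0 0) q.2) *
        (ENNReal.ofReal (1 / Real.pi) * phaseIntegral G q.2 (B q.1) (C q.1) (D q.1))) ?_
    exact Measurable.mul (by fun_prop) (Measurable.const_mul (measurable_phaseIntegral hG
      (by fun_prop) (by fun_prop) (by fun_prop) (by fun_prop)) _)
  have h₀ : ∀ z₁₁ z₁₀ z₀₁ : ℂ, ∫⁻ z₀₀,
        G (‖z₀₀‖ ^ 2 + ‖z₀₁‖ ^ 2 + ‖z₁₀‖ ^ 2 + ‖z₁₁‖ ^ 2) (‖z₀₀ * z₁₁ - z₀₁ * z₁₀‖ ^ 2)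
        ∂complexGaussian (φ 0 0) = R (‖z₀₁‖ ^ 2) (‖z₁₀‖ ^ 2) (‖z₁₁‖ ^ 2) := fun z₁₁ z₁₀ z₀₁ => by
    rw [lintegral_complexGaussian_mul_sub (hφ 0 0) (G := fun a δ =>
      G (a + ‖z₀₁‖ ^ 2 + ‖z₁₀‖ ^ 2 + ‖z₁₁‖ ^ 2) δ)
      (hG.comp (by fun_prop : Measurable fun p : ℝ × ℝ =>
        (p.1 + ‖z₀₁‖ ^ 2 + ‖z₁₀‖ ^ 2 + ‖z₁₁‖ ^ 2, p.2)))]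
    simp only [R, expDensity, phaseIntegral, Real.sqrt_sq (norm_nonneg _), norm_mul, mul_pow]
    refine lintegral_congr fun A => ?_
    congr 2
    refine lintegral_congr fun θ => ?_
    congr 1
    ring
  have h₁ : ∀ z₁₁ z₁₀ : ℂ, ∫⁻ z₀₁, R (‖z₀₁‖ ^ 2) (‖z₁₀‖ ^ 2) (‖z₁₁‖ ^ 2)
        ∂complexGaussian (φ 0 1) = ∫⁻ B in Set.Ioi 0, ENNReal.ofReal (expDensity (φ 0 1) B) *
          R B (‖z₁₀‖ ^ 2) (‖z₁₁‖ ^ 2) := fun z₁₁ z₁₀ => by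
    rw [lintegral_complexGaussian_norm (hφ 0 1)
      (h := fun r => R (r ^ 2) (‖z₁₀‖ ^ 2) (‖z₁₁‖ ^ 2))
      (hR (by fun_prop) (by fun_prop) (by fun_prop))]
    refine setLIntegral_congr_fun measurableSet_Ioi fun B hB => ?_
    rw [Real.sq_sqrt (le_of_lt hB), expDensity]
  have h₂ : ∀ z₁₁ : ℂ, ∫⁻ z₁₀, (∫⁻ B in Set.Ioi 0, ENNReal.ofReal (expDensity (φ 0 1) B) *
          R B (‖z₁₀‖ ^ 2) (‖z₁₁‖ ^ 2)) ∂complexGaussian (φ 1 0) =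
        ∫⁻ C in Set.Ioi 0, ENNReal.ofReal (expDensity (φ 1 0) C) *
          ∫⁻ B in Set.Ioi 0, ENNReal.ofReal (expDensity (φ 0 1) B) *
            R B C (‖z₁₁‖ ^ 2) := fun z₁₁ => by
    rw [lintegral_complexGaussian_norm (hφ 1 0) (h := fun r => ∫⁻ B in Set.Ioi 0,
      ENNReal.ofReal (expDensity (φ 0 1) B) * R B (r ^ 2) (‖z₁₁‖ ^ 2))]
    · refine setLIntegral_congr_fun measurableSet_Ioi fun C hC => ?_
      rw [Real.sq_sqrt (le_of_lt hC), expDensity]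
    · refine Measurable.lintegral_prod_right' (f := fun q : ℝ × ℝ =>
        ENNReal.ofReal (expDensity (φ 0 1) q.2) * R q.2 (q.1 ^ 2) (‖z₁₁‖ ^ 2)) ?_
      exact Measurable.mul (by fun_prop) (hR (by fun_prop) (by fun_prop) (by fun_prop))
  have h₃ : ∫⁻ z₁₁ : ℂ, (∫⁻ C in Set.Ioi 0, ENNReal.ofReal (expDensity (φ 1 0) C) *
          ∫⁻ B in Set.Ioi 0, ENNReal.ofReal (expDensity (φ 0 1) B) *
            R B C (‖z₁₁‖ ^ 2)) ∂complexGaussian (φ 1 1) =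
        ∫⁻ D in Set.Ioi 0, ENNReal.ofReal (expDensity (φ 1 1) D) *
          ∫⁻ C in Set.Ioi 0, ENNReal.ofReal (expDensity (φ 1 0) C) *
            ∫⁻ B in Set.Ioi 0, ENNReal.ofReal (expDensity (φ 0 1) B) * R B C D := by
    rw [lintegral_complexGaussian_norm (hφ 1 1) (h := fun r => ∫⁻ C in Set.Ioi 0,
      ENNReal.ofReal (expDensity (φ 1 0) C) * ∫⁻ B in Set.Ioi 0,
        ENNReal.ofReal (expDensity (φ 0 1) B) * R B C (r ^ 2))]
    · refine setLIntegral_congr_fun measurableSet_Ioi fun D hD => ?_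
      simp only [Real.sq_sqrt (le_of_lt hD), expDensity]
    · refine Measurable.lintegral_prod_right' (f := fun q : ℝ × ℝ =>
        ENNReal.ofReal (expDensity (φ 1 0) q.2) * ∫⁻ B in Set.Ioi 0,
          ENNReal.ofReal (expDensity (φ 0 1) B) * R B q.2 (q.1 ^ 2)) ?_
      refine Measurable.mul (by fun_prop) ?_
      refine Measurable.lintegral_prod_right' (f := fun q : (ℝ × ℝ) × ℝ =>
        ENNReal.ofReal (expDensity (φ 0 1) q.2) * R q.2 q.1.2 (q.1.1 ^ 2)) ?_
      exact Measurable.mul (by fun_prop) (hR (by fun_prop) (by fun_prop) (by fun_prop))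
  simp only [h₀, h₁, h₂, h₃, R, lintegral_const_mul' _ _ ENNReal.ofReal_ne_top]

/-- In the coordinates of the rows, the squared modulus of the determinant is
`x y (1 - t) / 2` with `t` the inner product of the Bloch vectors. -/
theorem phaseIntegral_bloch {G : ℝ → ℝ → ℝ≥0∞} {x y u v : ℝ} (hx : 0 < x) (hy : 0 < y)
    (hu : u ∈ Set.Ioo (-1 : ℝ) 1) (hv : v ∈ Set.Ioo (-1 : ℝ) 1) :
    phaseIntegral G (x * (1 - u) / 2) (x * (1 + u) / 2) (y * (1 - v) / 2) (y * (1 + v) / 2) =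
      ∫⁻ θ in Set.Ioo 0 Real.pi, G (x + y) (x * y *
        (1 - (v * u + √(1 - v ^ 2) * √(1 - u ^ 2) * Real.cos θ)) / 2) := by
  have hsqrt : ∀ {x u : ℝ}, 0 < x → u ∈ Set.Ioo (-1 : ℝ) 1 →
      √(x * (1 - u) / 2) * √(x * (1 + u) / 2) = x / 2 * √(1 - u ^ 2) := by
    intro x u hx hu
    have h1 : 0 < 1 - u := by linarith [hu.2]
    rw [← Real.sqrt_mul (by positivity),
      show x * (1 - u) / 2 * (x * (1 + u) / 2) = (x / 2) ^ 2 * (1 - u ^ 2) by ring,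
      Real.sqrt_mul (sq_nonneg _), Real.sqrt_sq (by positivity)]
  unfold phaseIntegral
  rw [hsqrt hx hu, hsqrt hy hv]
  refine lintegral_congr fun θ => ?_
  congr 1 <;> ring

theorem expDensity_row {v₀ v₁ : ℝ≥0} (x u : ℝ) :
    expDensity v₁ (x * (1 + u) / 2) * expDensity v₀ (x * (1 - u) / 2) =
      1 / v₀ * (1 / v₁) * Real.exp (-(x / 2 * (1 / v₀ + 1 / v₁))) *
        Real.exp (-(-(x / 2 * (1 / v₀ - 1 / v₁)) * u)) := by
  unfold expDensity
  rw [mul_mul_mul_comm, ← Real.exp_add, mul_assoc _ (Real.exp _), ← Real.exp_add,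
    mul_comm (1 / (v₁ : ℝ))]
  congr 2
  ring

/-- `η` as the squared norm of `x ε₁ n + y ε₂ m`, where `n`, `m` are unit vectors with inner
product `t`. -/
noncomputable def blochEta (φ : Fin 2 → Fin 2 → ℝ≥0) (x y t : ℝ) : ℝ :=
  x ^ 2 * profileEps φ 0 ^ 2 + y ^ 2 * profileEps φ 1 ^ 2 +
    2 * (x * y * t) * profileEps φ 0 * profileEps φ 1

/-- The density of the squared row norms `x`, `y` and the inner product `t` of the Bloch vectors
of the rows, up to the factor `x y`. -/
noncomputable def blochDensity (φ : Fin 2 → Fin 2 → ℝ≥0) (x y t : ℝ) : ℝ :=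
  profileK φ * (Real.exp (-(1 / 2) * (x * profileS φ 0 + y * profileS φ 1)) *
    (Real.sinh (1 / 2 * √(blochEta φ x y t)) / √(blochEta φ x y t)))

theorem profileK_eq (φ : Fin 2 → Fin 2 → ℝ≥0) : profileK φ =
    1 / φ 0 0 * (1 / φ 0 1) * (1 / φ 1 0 * (1 / φ 1 1)) := by
  simp only [profileK, Fin.prod_univ_two]

theorem profileK_nonneg (φ : Fin 2 → Fin 2 → ℝ≥0) : 0 ≤ profileK φ := by
  rw [profileK_eq]
  positivity

/-- Integrating out the heights and the relative longitude of the Bloch vectors of the rows, for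
fixed squared row norms `x`, `y`. -/
theorem lintegral_row_phases {φ : Fin 2 → Fin 2 → ℝ≥0} (hε : ∃ i, profileEps φ i ≠ 0)
    {G : ℝ → ℝ → ℝ≥0∞} (hG : Measurable fun p : ℝ × ℝ => G p.1 p.2) {x y : ℝ} (hx : 0 < x)
    (hy : 0 < y) :
    ∫⁻ v in Set.Ioo (-1) 1, ∫⁻ u in Set.Ioo (-1) 1, ENNReal.ofReal (y / 2) *
      (ENNReal.ofReal (x / 2) *
        (ENNReal.ofReal (expDensity (φ 1 1) (y * (1 + v) / 2)) *
          (ENNReal.ofReal (expDensity (φ 1 0) (y * (1 - v) / 2)) *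
            (ENNReal.ofReal (expDensity (φ 0 1) (x * (1 + u) / 2)) *
              (ENNReal.ofReal (expDensity (φ 0 0) (x * (1 - u) / 2)) *
                (ENNReal.ofReal (1 / Real.pi) *
                  phaseIntegral G (x * (1 - u) / 2) (x * (1 + u) / 2) (y * (1 - v) / 2)
                    (y * (1 + v) / 2))))))) =
      ∫⁻ t in Set.Ioo (-1) 1, ENNReal.ofReal (x * y) *
        (ENNReal.ofReal (blochDensity φ x y t) * G (x + y) (x * y * (1 - t) / 2)) := by
  obtain ⟨α, hα⟩ : ∃ α, α = -(y / 2 * profileEps φ 1) := ⟨_, rfl⟩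
  obtain ⟨β, hβ⟩ : ∃ β, β = -(x / 2 * profileEps φ 0) := ⟨_, rfl⟩
  have hαβ : α ≠ 0 ∨ β ≠ 0 := by
    obtain ⟨i, hi⟩ := hε
    fin_cases i
    · right
      rw [hβ]
      exact neg_ne_zero.2 (mul_ne_zero (by positivity) hi)
    · left
      rw [hα]
      exact neg_ne_zero.2 (mul_ne_zero (by positivity) hi)
  obtain ⟨c, hc⟩ : ∃ c, c = x * y / 4 * (1 / Real.pi) * (profileK φ *
      Real.exp (-(1 / 2) * (x * profileS φ 0 + y * profileS φ 1))) := ⟨_, rfl⟩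
  have hc0 : 0 ≤ c := by
    have := profileK_nonneg φ
    have := Real.pi_pos
    rw [hc]
    positivity
  calc
    _ = ∫⁻ v in Set.Ioo (-1) 1, ∫⁻ u in Set.Ioo (-1) 1, ENNReal.ofReal c *
          (ENNReal.ofReal (Real.exp (-(α * v + β * u))) *
            ∫⁻ θ in Set.Ioo 0 Real.pi, G (x + y) (x * y *
              (1 - (v * u + √(1 - v ^ 2) * √(1 - u ^ 2) * Real.cos θ)) / 2)) := by
      refine setLIntegral_congr_fun measurableSet_Ioo fun v hv =>
        setLIntegral_congr_fun measurableSet_Ioo fun u hu => ?_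
      have hreal : y / 2 * (x / 2 * (expDensity (φ 1 1) (y * (1 + v) / 2) *
          (expDensity (φ 1 0) (y * (1 - v) / 2) * (expDensity (φ 0 1) (x * (1 + u) / 2) *
            (expDensity (φ 0 0) (x * (1 - u) / 2) * (1 / Real.pi)))))) =
          c * Real.exp (-(α * v + β * u)) := by
        have h0 := expDensity_row (v₀ := φ 0 0) (v₁ := φ 0 1) x u
        have h1 := expDensity_row (v₀ := φ 1 0) (v₁ := φ 1 1) y v
        have hS : Real.exp (-(1 / 2) * (x * profileS φ 0 + y * profileS φ 1)) =
            Real.exp (-(x / 2 * (1 / φ 0 0 + 1 / φ 0 1))) *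
              Real.exp (-(y / 2 * (1 / φ 1 0 + 1 / φ 1 1))) := by
          rw [← Real.exp_add]
          unfold profileS
          congr 1
          ring
        have hE : Real.exp (-(α * v + β * u)) =
            Real.exp (-(-(y / 2 * (1 / φ 1 0 - 1 / φ 1 1)) * v)) *
              Real.exp (-(-(x / 2 * (1 / φ 0 0 - 1 / φ 0 1)) * u)) := by
          rw [← Real.exp_add, hα, hβ]
          unfold profileEps
          congr 1
          ring
        calc
          _ = y / 2 * (x / 2) * (1 / Real.pi) *
              (expDensity (φ 1 1) (y * (1 + v) / 2) * expDensity (φ 1 0) (y * (1 - v) / 2)) *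
              (expDensity (φ 0 1) (x * (1 + u) / 2) * expDensity (φ 0 0) (x * (1 - u) / 2)) := by
            ring
          _ = _ := by
            rw [h0, h1, hc, hS, hE, profileK_eq]
            ring
      have hπ := Real.pi_pos
      rw [phaseIntegral_bloch hx hy hu hv, ← mul_assoc (ENNReal.ofReal c),
        ← ENNReal.ofReal_mul hc0, ← hreal, ENNReal.ofReal_mul (by positivity),
        ENNReal.ofReal_mul (by positivity), ENNReal.ofReal_mul (expDensity_nonneg _ _),
        ENNReal.ofReal_mul (expDensity_nonneg _ _), ENNReal.ofReal_mul (expDensity_nonneg _ _),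
        ENNReal.ofReal_mul (expDensity_nonneg _ _)]
      simp only [mul_assoc]
    _ = ENNReal.ofReal c * ∫⁻ t in Set.Ioo (-1) 1,
          ENNReal.ofReal (2 * Real.pi * (Real.sinh √(α ^ 2 + β ^ 2 + 2 * α * β * t) /
            √(α ^ 2 + β ^ 2 + 2 * α * β * t))) * G (x + y) (x * y * (1 - t) / 2) := by
      rw [← lintegral_sphere_pair hαβ (g := fun t => G (x + y) (x * y * (1 - t) / 2))
        (hG.comp (by fun_prop : Measurable fun t : ℝ => (x + y, x * y * (1 - t) / 2)))]
      simp only [lintegral_const_mul' _ _ ENNReal.ofReal_ne_top]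
    _ = _ := by
      rw [← lintegral_const_mul' _ _ ENNReal.ofReal_ne_top]
      refine lintegral_congr fun t => ?_
      rw [← mul_assoc, ← mul_assoc, ← ENNReal.ofReal_mul hc0,
        ← ENNReal.ofReal_mul (by positivity)]
      have hN : √(α ^ 2 + β ^ 2 + 2 * α * β * t) = 1 / 2 * √(blochEta φ x y t) := by
        rw [show α ^ 2 + β ^ 2 + 2 * α * β * t = (1 / 2) ^ 2 * blochEta φ x y t by
          rw [hα, hβ]; unfold blochEta; ring, Real.sqrt_mul (by positivity),
          Real.sqrt_sq (by norm_num)]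
      have hπ := Real.pi_pos
      congr 2
      rw [hN, hc]
      unfold blochDensity
      field_simp
      ring

/-- The joint law of the squared row norms and the Bloch angle between the rows, tested against
functions of the trace and the determinant of the Gram matrix. -/
theorem lintegral_gaussian_bloch {φ : Fin 2 → Fin 2 → ℝ≥0} (hφ : ∀ i j, 0 < φ i j)
    (hε : ∃ i, profileEps φ i ≠ 0)
    {G : ℝ → ℝ → ℝ≥0∞} (hG : Measurable fun p : ℝ × ℝ => G p.1 p.2) :
    ∫⁻ z₁₁, ∫⁻ z₁₀, ∫⁻ z₀₁, ∫⁻ z₀₀,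
        G (‖z₀₀‖ ^ 2 + ‖z₀₁‖ ^ 2 + ‖z₁₀‖ ^ 2 + ‖z₁₁‖ ^ 2) (‖z₀₀ * z₁₁ - z₀₁ * z₁₀‖ ^ 2)
        ∂complexGaussian (φ 0 0) ∂complexGaussian (φ 0 1)
        ∂complexGaussian (φ 1 0) ∂complexGaussian (φ 1 1) =
      ∫⁻ x in Set.Ioi 0, ∫⁻ y in Set.Ioi 0, ∫⁻ t in Set.Ioo (-1) 1, ENNReal.ofReal (x * y) *
        (ENNReal.ofReal (blochDensity φ x y t) * G (x + y) (x * y * (1 - t) / 2)) := by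
  let Q : ℝ → ℝ → ℝ → ℝ → ℝ≥0∞ := fun D C B A =>
    ENNReal.ofReal (expDensity (φ 1 1) D) * (ENNReal.ofReal (expDensity (φ 1 0) C) *
      (ENNReal.ofReal (expDensity (φ 0 1) B) * (ENNReal.ofReal (expDensity (φ 0 0) A) *
        (ENNReal.ofReal (1 / Real.pi) * phaseIntegral G A B C D))))
  have hQ : ∀ {α : Type} [MeasurableSpace α] {D C B A : α → ℝ}, Measurable D → Measurable C →
      Measurable B → Measurable A → Measurable fun a => Q (D a) (C a) (B a) (A a) := by
    intro α _ D C B A hD hC hB hA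
    have := measurable_phaseIntegral hG hA hB hC hD
    simp only [Q]
    fun_prop
  rw [lintegral_gaussian_entries hφ hG]
  calc
    _ = ∫⁻ D in Set.Ioi 0, ∫⁻ C in Set.Ioi 0, ∫⁻ x in Set.Ioi 0, ∫⁻ u in Set.Ioo (-1) 1,
          ENNReal.ofReal (x / 2) * Q D C (x * (1 + u) / 2) (x * (1 - u) / 2) := by
      refine lintegral_congr fun D => lintegral_congr fun C => ?_
      exact lintegral_sum_ratio (g := Q D C) (hQ (by fun_prop) (by fun_prop) (by fun_prop)
        (by fun_prop))
    _ = ∫⁻ y in Set.Ioi 0, ∫⁻ v in Set.Ioo (-1) 1, ENNReal.ofReal (y / 2) *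
          ∫⁻ x in Set.Ioi 0, ∫⁻ u in Set.Ioo (-1) 1, ENNReal.ofReal (x / 2) *
            Q (y * (1 + v) / 2) (y * (1 - v) / 2) (x * (1 + u) / 2) (x * (1 - u) / 2) := by
      refine lintegral_sum_ratio (g := fun D C => ∫⁻ x in Set.Ioi 0, ∫⁻ u in Set.Ioo (-1) 1,
          ENNReal.ofReal (x / 2) * Q D C (x * (1 + u) / 2) (x * (1 - u) / 2)) ?_
      refine Measurable.lintegral_prod_right' (f := fun q : (ℝ × ℝ) × ℝ =>
        ∫⁻ u in Set.Ioo (-1) 1, ENNReal.ofReal (q.2 / 2) *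
          Q q.1.1 q.1.2 (q.2 * (1 + u) / 2) (q.2 * (1 - u) / 2)) ?_
      refine Measurable.lintegral_prod_right' (f := fun q : ((ℝ × ℝ) × ℝ) × ℝ =>
        ENNReal.ofReal (q.1.2 / 2) *
          Q q.1.1.1 q.1.1.2 (q.1.2 * (1 + q.2) / 2) (q.1.2 * (1 - q.2) / 2)) ?_
      exact Measurable.mul (by fun_prop) (hQ (by fun_prop) (by fun_prop) (by fun_prop)
        (by fun_prop))
    _ = ∫⁻ y in Set.Ioi 0, ∫⁻ v in Set.Ioo (-1) 1, ∫⁻ x in Set.Ioi 0, ∫⁻ u in Set.Ioo (-1) 1,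
          ENNReal.ofReal (y / 2) * (ENNReal.ofReal (x / 2) *
            Q (y * (1 + v) / 2) (y * (1 - v) / 2) (x * (1 + u) / 2) (x * (1 - u) / 2)) := by
      simp only [lintegral_const_mul' _ _ ENNReal.ofReal_ne_top]
    _ = ∫⁻ x in Set.Ioi 0, ∫⁻ y in Set.Ioi 0, ∫⁻ v in Set.Ioo (-1) 1, ∫⁻ u in Set.Ioo (-1) 1,
          ENNReal.ofReal (y / 2) * (ENNReal.ofReal (x / 2) *
            Q (y * (1 + v) / 2) (y * (1 - v) / 2) (x * (1 + u) / 2) (x * (1 - u) / 2)) := by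
      refine lintegral_lintegral_lintegral_rotate (k := fun y v x => ∫⁻ u in Set.Ioo (-1) 1,
          ENNReal.ofReal (y / 2) * (ENNReal.ofReal (x / 2) *
            Q (y * (1 + v) / 2) (y * (1 - v) / 2) (x * (1 + u) / 2) (x * (1 - u) / 2))) ?_
      refine Measurable.lintegral_prod_right' (f := fun q : (ℝ × ℝ × ℝ) × ℝ =>
        ENNReal.ofReal (q.1.1 / 2) * (ENNReal.ofReal (q.1.2.2 / 2) *
            Q (q.1.1 * (1 + q.1.2.1) / 2) (q.1.1 * (1 - q.1.2.1) / 2)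
              (q.1.2.2 * (1 + q.2) / 2) (q.1.2.2 * (1 - q.2) / 2))) ?_
      exact Measurable.mul (by fun_prop) (Measurable.mul (by fun_prop) (hQ (by fun_prop)
        (by fun_prop) (by fun_prop) (by fun_prop)))
    _ = _ :=
      setLIntegral_congr_fun measurableSet_Ioi fun x hx =>
        setLIntegral_congr_fun measurableSet_Ioi fun y hy => lintegral_row_phases hε hG hx hy

/-! ### The eigenvalues of the Gram matrix -/

/-- The squared Frobenius norm of `A`, which is the trace of `A Aᴴ`. -/
noncomputable def gramTrace (A : Matrix (Fin 2) (Fin 2) ℂ) : ℝ :=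
  ‖A 0 0‖ ^ 2 + ‖A 0 1‖ ^ 2 + ‖A 1 0‖ ^ 2 + ‖A 1 1‖ ^ 2

/-- The squared modulus of the determinant of `A`, which is the determinant of `A Aᴴ`. -/
noncomputable def gramDeterminant (A : Matrix (Fin 2) (Fin 2) ℂ) : ℝ :=
  ‖A 0 0 * A 1 1 - A 0 1 * A 1 0‖ ^ 2

/-- The roots of `X ^ 2 - S X + D`, the larger one first. -/
noncomputable def orderedRoots (S D : ℝ) : ℝ × ℝ :=
  ((S + √(S ^ 2 - 4 * D)) / 2, (S - √(S ^ 2 - 4 * D)) / 2)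

theorem measurable_orderedRoots : Measurable fun p : ℝ × ℝ => orderedRoots p.1 p.2 := by
  unfold orderedRoots
  fun_prop

theorem orderedRoots_add_mul {x y : ℝ} (h : y ≤ x) : orderedRoots (x + y) (x * y) = (x, y) := by
  unfold orderedRoots
  rw [show (x + y) ^ 2 - 4 * (x * y) = (x - y) ^ 2 by ring, Real.sqrt_sq (sub_nonneg.2 h)]
  ext <;> dsimp only <;> ring

theorem gramEigenvalue_one_le_zero (A : Matrix (Fin 2) (Fin 2) ℂ) :
    gramEigenvalue A 1 ≤ gramEigenvalue A 0 :=
  (Matrix.isHermitian_mul_conjTranspose_self A).eigenvalues₀_antitone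
    (by simp)

/-- The bijection between the two index types of the eigenvalues of `A Aᴴ` used by Mathlib. -/
noncomputable def gramEigenvalueIndex : Fin 2 ≃ Fin 2 :=
  (Fintype.equivOfCardEq (Fintype.card_fin (Fintype.card (Fin 2)))).symm.trans
    (finCongr (Fintype.card_fin 2))

theorem gramEigenvalue_add (A : Matrix (Fin 2) (Fin 2) ℂ) :
    gramEigenvalue A 0 + gramEigenvalue A 1 = gramTrace A := by
  have h : (A * A.conjTranspose).trace =
      ∑ i, ((gramEigenvalue A (gramEigenvalueIndex i) : ℝ) : ℂ) :=
    (Matrix.isHermitian_mul_conjTranspose_self A).trace_eq_sum_eigenvalues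
  rw [Equiv.sum_comp gramEigenvalueIndex fun i => ((gramEigenvalue A i : ℝ) : ℂ),
    Fin.sum_univ_two] at h
  have ht : (A * A.conjTranspose).trace = ((gramTrace A : ℝ) : ℂ) := by
    simp only [Matrix.trace_fin_two, Matrix.mul_apply, Fin.sum_univ_two,
      Matrix.conjTranspose_apply, RCLike.star_def, Complex.mul_conj, gramTrace,
      Complex.normSq_eq_norm_sq]
    push_cast
    ring
  exact_mod_cast h.symm.trans ht

theorem gramEigenvalue_mul (A : Matrix (Fin 2) (Fin 2) ℂ) :
    gramEigenvalue A 0 * gramEigenvalue A 1 = gramDeterminant A := by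
  have h : (A * A.conjTranspose).det =
      ∏ i, ((gramEigenvalue A (gramEigenvalueIndex i) : ℝ) : ℂ) :=
    (Matrix.isHermitian_mul_conjTranspose_self A).det_eq_prod_eigenvalues
  rw [Equiv.prod_comp gramEigenvalueIndex fun i => ((gramEigenvalue A i : ℝ) : ℂ),
    Fin.prod_univ_two] at h
  have ht : (A * A.conjTranspose).det = ((gramDeterminant A : ℝ) : ℂ) := by
    rw [Matrix.det_mul, Matrix.det_conjTranspose, RCLike.star_def, Complex.mul_conj,
      Matrix.det_fin_two, gramDeterminant, Complex.normSq_eq_norm_sq]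
  exact_mod_cast h.symm.trans ht

theorem gramEigenvalue_pair (A : Matrix (Fin 2) (Fin 2) ℂ) :
    (gramEigenvalue A 0, gramEigenvalue A 1) = orderedRoots (gramTrace A) (gramDeterminant A) := by
  rw [← gramEigenvalue_add, ← gramEigenvalue_mul,
    orderedRoots_add_mul (gramEigenvalue_one_le_zero A)]

/-! ### The law of the eigenvalues -/

instance isProbabilityMeasure_complexGaussian (v : ℝ≥0) :
    IsProbabilityMeasure (complexGaussian v) :=
  Measure.isProbabilityMeasure_map Complex.measurableEquivRealProd.symm.measurable.aemeasurable

/-- The matrix entries, listed from the last one to the first one, as a function on the index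
set. -/
def entryFun (z : ℂ × ℂ × ℂ × ℂ) (ij : Fin 2 × Fin 2) : ℂ :=
  ![![z.2.2.2, z.2.2.1], ![z.2.1, z.1]] ij.1 ij.2

theorem measurable_entryFun : Measurable entryFun := by
  refine measurable_pi_lambda _ fun ij => ?_
  obtain ⟨i, j⟩ := ij
  fin_cases i <;> fin_cases j <;> simp only [entryFun] <;> dsimp <;> fun_prop

theorem pi_eq_map_entryFun (μ : Fin 2 → Fin 2 → Measure ℂ) [∀ i j, IsProbabilityMeasure (μ i j)] :
    Measure.pi (fun ij : Fin 2 × Fin 2 => μ ij.1 ij.2) =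
      ((μ 1 1).prod ((μ 1 0).prod ((μ 0 1).prod (μ 0 0)))).map entryFun := by
  refine Measure.pi_eq fun s hs => ?_
  rw [Measure.map_apply measurable_entryFun (MeasurableSet.univ_pi hs)]
  have hpre : entryFun ⁻¹' Set.univ.pi s = s (1, 1) ×ˢ s (1, 0) ×ˢ s (0, 1) ×ˢ s (0, 0) := by
    ext z
    simp only [Set.mem_preimage, Set.mem_pi, Set.mem_univ, true_implies, Set.mem_prod, Prod.forall,
      Fin.forall_fin_two, entryFun, Matrix.cons_val_zero, Matrix.cons_val_one]
    tauto
  rw [hpre, Measure.prod_prod, Measure.prod_prod, Measure.prod_prod, Fintype.prod_prod_type,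
    Fin.prod_univ_two, Fin.prod_univ_two, Fin.prod_univ_two]
  ring

theorem lintegral_independent_entries {Ω : Type*} [MeasurableSpace Ω] {P : Measure Ω}
    [IsProbabilityMeasure P] {φ : Fin 2 → Fin 2 → ℝ≥0} {H : Ω → Matrix (Fin 2) (Fin 2) ℂ}
    (hindep : iIndepFun (fun (ij : Fin 2 × Fin 2) (ω : Ω) => H ω ij.1 ij.2) P)
    (hlaw : ∀ i j, HasLaw (fun ω => H ω i j) (complexGaussian (φ i j)) P)
    {G : ℝ → ℝ → ℝ≥0∞} (hG : Measurable fun p : ℝ × ℝ => G p.1 p.2) :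
    ∫⁻ ω, G (gramTrace (H ω)) (gramDeterminant (H ω)) ∂P =
      ∫⁻ z₁₁, ∫⁻ z₁₀, ∫⁻ z₀₁, ∫⁻ z₀₀,
        G (‖z₀₀‖ ^ 2 + ‖z₀₁‖ ^ 2 + ‖z₁₀‖ ^ 2 + ‖z₁₁‖ ^ 2) (‖z₀₀ * z₁₁ - z₀₁ * z₁₀‖ ^ 2)
        ∂complexGaussian (φ 0 0) ∂complexGaussian (φ 0 1)
        ∂complexGaussian (φ 1 0) ∂complexGaussian (φ 1 1) := by
  have hae : ∀ ij : Fin 2 × Fin 2, AEMeasurable (fun ω => H ω ij.1 ij.2) P :=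
    fun ij => (hlaw ij.1 ij.2).aemeasurable
  have hmap := (iIndepFun_iff_map_fun_eq_pi_map hae).1 hindep
  have hmarg : (fun ij : Fin 2 × Fin 2 => P.map fun ω => H ω ij.1 ij.2) =
      fun ij => complexGaussian (φ ij.1 ij.2) := funext fun ij => (hlaw ij.1 ij.2).map_eq
  rw [hmarg, pi_eq_map_entryFun fun i j => complexGaussian (φ i j)] at hmap
  let F : (Fin 2 × Fin 2 → ℂ) → ℝ≥0∞ := fun M =>
    G (‖M (0, 0)‖ ^ 2 + ‖M (0, 1)‖ ^ 2 + ‖M (1, 0)‖ ^ 2 + ‖M (1, 1)‖ ^ 2)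
      (‖M (0, 0) * M (1, 1) - M (0, 1) * M (1, 0)‖ ^ 2)
  have hF : Measurable F := hG.comp (by fun_prop : Measurable fun M : Fin 2 × Fin 2 → ℂ =>
    (‖M (0, 0)‖ ^ 2 + ‖M (0, 1)‖ ^ 2 + ‖M (1, 0)‖ ^ 2 + ‖M (1, 1)‖ ^ 2,
      ‖M (0, 0) * M (1, 1) - M (0, 1) * M (1, 0)‖ ^ 2))
  have hG4 : ∀ {α : Type} [MeasurableSpace α] {a b c d : α → ℂ}, Measurable a → Measurable b →
      Measurable c → Measurable d → Measurable fun z =>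
        G (‖a z‖ ^ 2 + ‖b z‖ ^ 2 + ‖c z‖ ^ 2 + ‖d z‖ ^ 2) (‖a z * d z - b z * c z‖ ^ 2) := by
    intro α _ a b c d ha hb hc hd
    exact hG.comp (by fun_prop : Measurable fun z =>
      (‖a z‖ ^ 2 + ‖b z‖ ^ 2 + ‖c z‖ ^ 2 + ‖d z‖ ^ 2, ‖a z * d z - b z * c z‖ ^ 2))
  calc
    _ = ∫⁻ M, F M ∂(P.map fun ω (ij : Fin 2 × Fin 2) => H ω ij.1 ij.2) :=
      (lintegral_map' hF.aemeasurable (aemeasurable_pi_lambda _ hae)).symm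
    _ = ∫⁻ z, G (‖z.2.2.2‖ ^ 2 + ‖z.2.2.1‖ ^ 2 + ‖z.2.1‖ ^ 2 + ‖z.1‖ ^ 2)
          (‖z.2.2.2 * z.1 - z.2.2.1 * z.2.1‖ ^ 2) ∂((complexGaussian (φ 1 1)).prod
            ((complexGaussian (φ 1 0)).prod
              ((complexGaussian (φ 0 1)).prod (complexGaussian (φ 0 0))))) := by
      rw [hmap, lintegral_map hF measurable_entryFun]
      rfl
    _ = _ := by
      rw [lintegral_prod _ (hG4 (by fun_prop) (by fun_prop) (by fun_prop)
        (by fun_prop)).aemeasurable]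
      refine lintegral_congr fun z₁₁ => ?_
      rw [lintegral_prod _ (hG4 (by fun_prop) (by fun_prop) (by fun_prop)
        (by fun_prop)).aemeasurable]
      refine lintegral_congr fun z₁₀ => ?_
      rw [lintegral_prod _ (hG4 (by fun_prop) (by fun_prop) (by fun_prop)
        (by fun_prop)).aemeasurable]

theorem aemeasurable_gramEigenvalue_pair {Ω : Type*} [MeasurableSpace Ω] {P : Measure Ω}
    {H : Ω → Matrix (Fin 2) (Fin 2) ℂ} (hH : ∀ i j, AEMeasurable (fun ω => H ω i j) P) :
    AEMeasurable (fun ω => (gramEigenvalue (H ω) 0, gramEigenvalue (H ω) 1)) P := by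
  simp only [gramEigenvalue_pair]
  refine measurable_orderedRoots.comp_aemeasurable (f := fun ω =>
    (gramTrace (H ω), gramDeterminant (H ω))) ?_
  have h00 := hH 0 0
  have h01 := hH 0 1
  have h10 := hH 1 0
  have h11 := hH 1 1
  unfold gramTrace gramDeterminant
  fun_prop

/-! ### The density -/

theorem measurable_eigenIntegrand (φ : Fin 2 → Fin 2 → ℝ≥0) :
    Measurable fun q : (ℝ × ℝ) × ℝ => eigenIntegrand φ q.1.1 q.1.2 q.2 := by
  unfold eigenIntegrand nuFun etaFun aCoef bCoef
  fun_prop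

theorem measurable_eigenIntegrand_right (φ : Fin 2 → Fin 2 → ℝ≥0) (x y : ℝ) :
    Measurable (eigenIntegrand φ x y) := by
  change Measurable fun κ => eigenIntegrand φ x y κ
  unfold eigenIntegrand nuFun etaFun aCoef bCoef
  fun_prop

theorem measurable_eigenDensity (φ : Fin 2 → Fin 2 → ℝ≥0) :
    Measurable fun p : ℝ × ℝ => eigenDensity φ p.1 p.2 := by
  unfold eigenDensity
  simp only [intervalIntegral.integral_of_le Real.pi_div_two_pos.le]
  refine Measurable.mul (by fun_prop) ?_
  exact ((measurable_eigenIntegrand φ).stronglyMeasurable.integral_prod_right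
    (ν := volume.restrict (Set.Ioc 0 (Real.pi / 2)))).measurable

theorem intervalIntegrable_eigenIntegrand (φ : Fin 2 → Fin 2 → ℝ≥0) (x y : ℝ) :
    IntervalIntegrable (eigenIntegrand φ x y) volume 0 (Real.pi / 2) := by
  have hslope : Continuous (dslope Real.sinh 0) := continuous_iff_continuousAt.2 fun w => by
    rcases eq_or_ne w 0 with rfl | hw
    · exact continuousAt_dslope_same.2 Real.differentiable_sinh.differentiableAt
    · exact (continuousAt_dslope_of_ne hw).2 Real.continuous_sinh.continuousAt
  -- The integrand is dominated by its continuous version, from which it differs where `η = 0`.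
  have hcont : Continuous fun κ => Real.exp (-(1 / 2) * nuFun φ x y κ) *
      (1 / 2 * dslope Real.sinh 0 (1 / 2 * √(etaFun φ x y κ))) * Real.sin (2 * κ) := by
    unfold nuFun etaFun aCoef bCoef
    fun_prop
  refine (hcont.intervalIntegrable 0 (Real.pi / 2)).mono_fun ?_ (Filter.Eventually.of_forall ?_)
  · exact (measurable_eigenIntegrand_right φ x y).aestronglyMeasurable
  · intro κ
    dsimp only [eigenIntegrand]
    rcases eq_or_ne √(etaFun φ x y κ) 0 with h | h
    · rw [h, div_zero, mul_zero, zero_mul, norm_zero]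
      exact norm_nonneg _
    · refine le_of_eq ?_
      rw [dslope_of_ne _ (mul_ne_zero (one_div_ne_zero two_ne_zero) h), slope_def_field,
        Real.sinh_zero, sub_zero, sub_zero]
      congr 3
      field_simp

theorem eigenIntegrand_nonneg (φ : Fin 2 → Fin 2 → ℝ≥0) (x y : ℝ) {κ : ℝ}
    (hκ : κ ∈ Set.Ioc 0 (Real.pi / 2)) : 0 ≤ eigenIntegrand φ x y κ := by
  have h1 : 0 ≤ Real.sin (2 * κ) :=
    Real.sin_nonneg_of_nonneg_of_le_pi (by linarith [hκ.1]) (by linarith [hκ.2])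
  have h2 : 0 ≤ Real.sinh (1 / 2 * √(etaFun φ x y κ)) :=
    Real.sinh_nonneg_iff.2 (by positivity)
  unfold eigenIntegrand
  positivity

theorem ofReal_eigenDensity (φ : Fin 2 → Fin 2 → ℝ≥0) (x y : ℝ) :
    ENNReal.ofReal (eigenDensity φ x y) = ∫⁻ κ in Set.Ioo 0 (Real.pi / 2),
      ENNReal.ofReal (2 * profileK φ * (x - y) ^ 2 * eigenIntegrand φ x y κ) := by
  have hK := profileK_nonneg φ
  have hint := (intervalIntegrable_iff_integrableOn_Ioc_of_le Real.pi_div_two_pos.le).1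
    (intervalIntegrable_eigenIntegrand φ x y)
  simp only [ENNReal.ofReal_mul (show 0 ≤ 2 * profileK φ * (x - y) ^ 2 by positivity)]
  rw [lintegral_const_mul' _ _ ENNReal.ofReal_ne_top, eigenDensity,
    intervalIntegral.integral_of_le Real.pi_div_two_pos.le, ENNReal.ofReal_mul (by positivity),
    ofReal_integral_eq_lintegral_ofReal hint, restrict_Ioo_eq_restrict_Ioc]
  exact (ae_restrict_iff' measurableSet_Ioc).2
    (Filter.Eventually.of_forall fun κ hκ => eigenIntegrand_nonneg φ x y hκ)

/-- In eigenvalue coordinates the integrand of `lintegral_eigenvalue_coordinates` becomes the one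
that defines `eigenDensity`; in particular `blochEta` becomes `etaFun`. -/
theorem eigen_coordinates_density (φ : Fin 2 → Fin 2 → ℝ≥0) {x y κ : ℝ} (hx : 0 < x) (hy : 0 < y)
    (f : ℝ × ℝ → ℝ≥0∞) (hyx : y < x) (hκ : κ ∈ Set.Ioo 0 (Real.pi / 2)) :
    ENNReal.ofReal (2 * (x - y) ^ 2 * Real.sin (2 * κ)) *
        (ENNReal.ofReal (blochDensity φ (aCoef κ * x + bCoef κ * y) (bCoef κ * x + aCoef κ * y)
          (1 - 2 * (x * y) / ((aCoef κ * x + bCoef κ * y) * (bCoef κ * x + aCoef κ * y)))) *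
        f (orderedRoots (aCoef κ * x + bCoef κ * y + (bCoef κ * x + aCoef κ * y))
          ((aCoef κ * x + bCoef κ * y) * (bCoef κ * x + aCoef κ * y) *
            (1 - (1 - 2 * (x * y) /
              ((aCoef κ * x + bCoef κ * y) * (bCoef κ * x + aCoef κ * y)))) / 2))) =
      ENNReal.ofReal (2 * profileK φ * (x - y) ^ 2 * eigenIntegrand φ x y κ) * f (x, y) := by
  have hs : 0 < Real.sin (2 * κ) :=
    Real.sin_pos_of_pos_of_lt_pi (by linarith [hκ.1]) (by linarith [hκ.2])
  have ha : 0 < aCoef κ :=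
    pow_pos (Real.cos_pos_of_mem_Ioo ⟨by linarith [hκ.1, Real.pi_pos], hκ.2⟩) 2
  have hb : 0 ≤ bCoef κ := sq_nonneg _
  have hab : aCoef κ + bCoef κ = 1 := Real.cos_sq_add_sin_sq κ
  obtain ⟨X, hX⟩ : ∃ X, X = aCoef κ * x + bCoef κ * y := ⟨_, rfl⟩
  obtain ⟨Y, hY⟩ : ∃ Y, Y = bCoef κ * x + aCoef κ * y := ⟨_, rfl⟩
  have hX0 : 0 < X := by rw [hX]; positivity
  have hY0 : 0 < Y := by rw [hY]; positivity
  have hsum : X + Y = x + y := by rw [hX, hY]; linear_combination (x + y) * hab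
  have hprod : X * Y * (1 - (1 - 2 * (x * y) / (X * Y))) / 2 = x * y := by field_simp; ring
  have heta : blochEta φ X Y (1 - 2 * (x * y) / (X * Y)) = etaFun φ x y κ := by
    have h1 : X * Y * (1 - 2 * (x * y) / (X * Y)) =
        aCoef κ * bCoef κ * (x - y) ^ 2 - x * y := by
      have h2 : X * Y * (1 - 2 * (x * y) / (X * Y)) = X * Y - 2 * (x * y) := by
        field_simp
      rw [h2, hX, hY]
      linear_combination (aCoef κ + bCoef κ + 1) * x * y * hab
    unfold blochEta etaFun
    rw [h1, hX, hY]
  rw [← hX, ← hY, hsum, hprod, orderedRoots_add_mul hyx.le, ← mul_assoc,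
    ← ENNReal.ofReal_mul (by positivity)]
  congr 2
  unfold blochDensity eigenIntegrand nuFun
  rw [heta, ← hX, ← hY]
  ring

theorem lintegral_gramEigenvalue {Ω : Type*} [MeasurableSpace Ω] {P : Measure Ω}
    [IsProbabilityMeasure P] {φ : Fin 2 → Fin 2 → ℝ≥0} (hφ : ∀ i j, 0 < φ i j)
    (hε : ∃ i, profileEps φ i ≠ 0) {H : Ω → Matrix (Fin 2) (Fin 2) ℂ}
    (hindep : iIndepFun (fun (ij : Fin 2 × Fin 2) (ω : Ω) => H ω ij.1 ij.2) P)
    (hlaw : ∀ i j, HasLaw (fun ω => H ω i j) (complexGaussian (φ i j)) P)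
    {f : ℝ × ℝ → ℝ≥0∞} (hf : Measurable f) :
    ∫⁻ ω, f (gramEigenvalue (H ω) 0, gramEigenvalue (H ω) 1) ∂P =
      ∫⁻ x in Set.Ioi 0, ∫⁻ y in Set.Ioi 0, {p : ℝ × ℝ | p.2 < p.1}.indicator
        (fun p => ENNReal.ofReal (eigenDensity φ p.1 p.2) * f p) (x, y) := by
  have hG : Measurable fun p : ℝ × ℝ => f (orderedRoots p.1 p.2) :=
    hf.comp measurable_orderedRoots
  simp only [gramEigenvalue_pair]
  rw [lintegral_independent_entries hindep hlaw (G := fun S D => f (orderedRoots S D)) hG,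
    lintegral_gaussian_bloch hφ hε (G := fun S D => f (orderedRoots S D)) hG,
    lintegral_eigenvalue_coordinates (k := fun x y t => ENNReal.ofReal (blochDensity φ x y t) *
      f (orderedRoots (x + y) (x * y * (1 - t) / 2)))]
  · refine setLIntegral_congr_fun measurableSet_Ioi fun x hx =>
      setLIntegral_congr_fun measurableSet_Ioi fun y hy => ?_
    by_cases hyx : (x, y) ∈ {p : ℝ × ℝ | p.2 < p.1}
    · rw [Set.indicator_of_mem hyx, Set.indicator_of_mem hyx, ofReal_eigenDensity,
        ← lintegral_mul_const _ (Measurable.ennreal_ofReal (Measurable.const_mul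
          (measurable_eigenIntegrand_right φ x y) _))]
      exact setLIntegral_congr_fun measurableSet_Ioo fun κ hκ =>
        eigen_coordinates_density φ hx hy f hyx hκ
    · rw [Set.indicator_of_notMem hyx, Set.indicator_of_notMem hyx]
  · refine Measurable.mul ?_ (hG.comp (by fun_prop : Measurable fun p : ℝ × ℝ × ℝ =>
      (p.1 + p.2.1, p.1 * p.2.1 * (1 - p.2.2) / 2)))
    unfold blochDensity blochEta
    fun_prop

theorem map_gramEigenvalue_eq_withDensity {Ω : Type*} [MeasurableSpace Ω] {P : Measure Ω}
    [IsProbabilityMeasure P] {φ : Fin 2 → Fin 2 → ℝ≥0} (hφ : ∀ i j, 0 < φ i j)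
    (hε : ∃ i, profileEps φ i ≠ 0) {H : Ω → Matrix (Fin 2) (Fin 2) ℂ}
    (hindep : iIndepFun (fun (ij : Fin 2 × Fin 2) (ω : Ω) => H ω ij.1 ij.2) P)
    (hlaw : ∀ i j, HasLaw (fun ω => H ω i j) (complexGaussian (φ i j)) P) :
    P.map (fun ω => (gramEigenvalue (H ω) 0, gramEigenvalue (H ω) 1)) =
      (volume : Measure (ℝ × ℝ)).withDensity ({p : ℝ × ℝ | p.2 ≤ p.1 ∧ 0 < p.2}.indicator
        fun p => ENNReal.ofReal (eigenDensity φ p.1 p.2)) := by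
  have hR : MeasurableSet {p : ℝ × ℝ | p.2 ≤ p.1 ∧ 0 < p.2} :=
    (measurableSet_le measurable_snd measurable_fst).inter
      (measurableSet_lt measurable_const measurable_snd)
  have hlt : MeasurableSet {p : ℝ × ℝ | p.2 < p.1} :=
    measurableSet_lt measurable_snd measurable_fst
  have hdens := (measurable_eigenDensity φ).ennreal_ofReal
  refine Measure.ext_of_lintegral _ fun f hf => ?_
  have hm : Measurable ({p : ℝ × ℝ | p.2 < p.1}.indicator
      fun p => ENNReal.ofReal (eigenDensity φ p.1 p.2) * f p) := (hdens.mul hf).indicator hlt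
  rw [lintegral_map' hf.aemeasurable
      (aemeasurable_gramEigenvalue_pair fun i j => (hlaw i j).aemeasurable),
    lintegral_gramEigenvalue hφ hε hindep hlaw hf,
    lintegral_withDensity_eq_lintegral_mul _ (hdens.indicator hR) hf,
    ← lintegral_prod _ hm.aemeasurable, Measure.prod_restrict, ← Measure.volume_eq_prod,
    ← lintegral_indicator (measurableSet_Ioi.prod measurableSet_Ioi)]
  refine lintegral_congr fun p => ?_
  obtain ⟨x, y⟩ := p
  rcases lt_trichotomy y x with h | rfl | h
  · by_cases hy : 0 < y
    · have h1 : (x, y) ∈ Set.Ioi (0 : ℝ) ×ˢ Set.Ioi (0 : ℝ) := ⟨hy.trans h, hy⟩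
      have h2 : (x, y) ∈ {p : ℝ × ℝ | p.2 < p.1} := h
      have h3 : (x, y) ∈ {p : ℝ × ℝ | p.2 ≤ p.1 ∧ 0 < p.2} := ⟨h.le, hy⟩
      rw [Set.indicator_of_mem h1, Set.indicator_of_mem h2, Pi.mul_apply, Set.indicator_of_mem h3]
    · rw [Set.indicator_of_notMem fun h1 => hy h1.2, Pi.mul_apply,
        Set.indicator_of_notMem fun h3 => hy h3.2, zero_mul]
  · -- On the diagonal the claimed density vanishes.
    have h0 : eigenDensity φ y y = 0 := by simp [eigenDensity]
    simp [Set.indicator, h0]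
  · have h2 : (x, y) ∉ {p : ℝ × ℝ | p.2 < p.1} := not_lt.2 h.le
    have h3 : (x, y) ∉ {p : ℝ × ℝ | p.2 ≤ p.1 ∧ 0 < p.2} := fun h3 => not_le.2 h h3.1
    rw [Pi.mul_apply, Set.indicator_of_notMem h3, zero_mul]
    exact Set.indicator_apply_eq_zero.2 fun _ => Set.indicator_of_notMem h2 _

theorem theorem2 {Ω : Type*} [MeasurableSpace Ω] (P : Measure Ω) [IsProbabilityMeasure P]
    (φ : Fin 2 → Fin 2 → ℝ≥0) (hφ : ∀ i j, 0 < φ i j)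
    (hε : ∃ i, profileEps φ i ≠ 0)
    (H : Ω → Matrix (Fin 2) (Fin 2) ℂ)
    (hindep : iIndepFun (fun (ij : Fin 2 × Fin 2) (ω : Ω) => H ω ij.1 ij.2) P)
    (hlaw : ∀ i j, HasLaw (fun ω => H ω i j) (complexGaussian (φ i j)) P) :
    (∀ x y : ℝ, y ≤ x → 0 < y →
      IntervalIntegrable (eigenIntegrand φ x y) volume 0 (Real.pi / 2)) ∧
    HasPDF (fun ω => (gramEigenvalue (H ω) 0, gramEigenvalue (H ω) 1)) P
      (volume : Measure (ℝ × ℝ)) ∧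
    pdf (fun ω => (gramEigenvalue (H ω) 0, gramEigenvalue (H ω) 1)) P
        (volume : Measure (ℝ × ℝ))
      =ᵐ[volume] Set.indicator {p : ℝ × ℝ | p.2 ≤ p.1 ∧ 0 < p.2}
        (fun p => ENNReal.ofReal (eigenDensity φ p.1 p.2)) := by
  have hmap := map_gramEigenvalue_eq_withDensity hφ hε hindep hlaw
  have hae := aemeasurable_gramEigenvalue_pair fun i j => (hlaw i j).aemeasurable
  have hdens : Measurable ({p : ℝ × ℝ | p.2 ≤ p.1 ∧ 0 < p.2}.indicator
      fun p => ENNReal.ofReal (eigenDensity φ p.1 p.2)) :=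
    (measurable_eigenDensity φ).ennreal_ofReal.indicator
      ((measurableSet_le measurable_snd measurable_fst).inter
        (measurableSet_lt measurable_const measurable_snd))
  have hpdf := hasPDF_of_map_eq_withDensity hae _ hdens.aemeasurable hmap
  exact ⟨fun x y _ _ => intervalIntegrable_eigenIntegrand φ x y, hpdf,
    (pdf.eq_of_map_eq_withDensity _ hdens.aemeasurable).1 hmap⟩
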